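/- For $\mu>-1$, $a\in\mathbb R$ let $g(\lambda)=|\lambda-a|^{\mu}e^{-\lambda^2}$, let $p_0,p_1,\dots$ be the monic orthogonal polynomials of the weight $g$ on $\mathbb R$, $\mathcal N_j=\int_{-\infty}^{\infty} g\,p_j^2\,d\lambda$, and let $$K_N(X,Y)=(g(X)g(Y))^{1/2}\sum_{j=0}^{N-1}\frac{p_j(X)p_j(Y)}{\mathcal N_j}$$ be the correlation kernel of the GUE with a spectrum singularity at $a$. For $\mu=2m$, $m\in\{0,1,2,\dots\}$, take for $(g(X)g(Y))^{1/2}$ the product $h(X)h(Y)$ of the smooth square roots $h(\lambda)=(\lambda-a)^m e^{-\lambda^2/2}$. For real $x,y,c$ define the soft-edge kernel, with the singularity placed at the origin of the scaled coordinates, by $$K^{\rm soft}_{2m}(x,y;c)=\lim_{N\to\infty}\frac1{\sqrt2N^{1/6}}\,K_N\Big(a+\frac{x}{\sqrt2N^{1/6}},\,a+\frac{y}{\sqrt2N^{1/6}}\Big)\Big|_{\mu=2m,\ a=\sqrt{2N}+c/(\sqrt2N^{1/6})}.$$ Proposition. For all $m\in\{0,1,2,\dots\}$ and all real $x,y,c$,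 the limits defining $K^{\rm soft}_{2m}(x,y;c)$ and $K^{\rm soft}_{2m+2}(x,y;c)$ exist, $K^{\rm soft}_{2m}(z,z;c)\neq0$ for all sufficiently small $z\ne0$, and $$K^{\rm soft}_{2m+2}(x,y;c)=\lim_{z\to0,\ z\neq0}\frac{K^{\rm soft}_{2m}(x,y;c)K^{\rm soft}_{2m}(z,z;c)-K^{\rm soft}_{2m}(x,z;c)K^{\rm soft}_{2m}(z,y;c)}{K^{\rm soft}_{2m}(z,z;c)}.$$ If instead the nonnegative square root of $g(X)g(Y)$ is used in $K_N$ (which changes the kernels only by signs and gives the same correlation functions), the same statements hold, except that for $xy<0$ the left side of the last formula is to be replaced by $-K^{\rm soft}_{2m+2}(x,y;c)$. -/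

import Mathlib

/-- The weight `g(t) = |t - a|^μ e^{-t²}` of the Gaussian unitary ensemble with a spectrum
singularity of exponent `μ` at the point `a`. -/
noncomputable def gueWeight (μ a t : ℝ) : ℝ := |t - a| ^ μ * Real.exp (-t ^ 2)

/-- The monic orthogonal polynomials `p_0, p_1, …` of the weight `g` on the real line,
obtained from `1, X, X², …` by the Gram-Schmidt process. -/
noncomputable def orthoPoly (g : ℝ → ℝ) : ℕ → Polynomial ℝ
  | n => Polynomial.X ^ n - ∑ j : Fin n,
      Polynomial.C ((∫ t : ℝ, g t * (t ^ n * (orthoPoly g j).eval t)) /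
        (∫ t : ℝ, g t * (orthoPoly g j).eval t ^ 2)) * orthoPoly g j
termination_by n => n
decreasing_by all_goals exact j.2

/-- The squared norms `𝒩_n = ∫ g p_n²`. -/
noncomputable def orthoNorm (g : ℝ → ℝ) (n : ℕ) : ℝ :=
  ∫ t : ℝ, g t * (orthoPoly g n).eval t ^ 2

/-- The sum `∑_{j < N} p_j(x) p_j(y) / 𝒩_j`. -/
noncomputable def polyKernel (g : ℝ → ℝ) (N : ℕ) (x y : ℝ) : ℝ :=
  ∑ j ∈ Finset.range N, (orthoPoly g j).eval x * (orthoPoly g j).eval y / orthoNorm g j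

/-- The correlation kernel of the `N`-point ensemble with weight `|t - a|^μ e^{-t²}`, written
with the nonnegative square root of `g(x) g(y)`. -/
noncomputable def absKernel (μ a : ℝ) (N : ℕ) (x y : ℝ) : ℝ :=
  Real.sqrt (gueWeight μ a x * gueWeight μ a y) * polyKernel (gueWeight μ a) N x y

/-- The square root `(t - a)^m e^{-t²/2}` of the weight `|t - a|^{2m} e^{-t²}` that is a smooth
function of `t`. -/
noncomputable def smoothRoot (m : ℕ) (a t : ℝ) : ℝ := (t - a) ^ m * Real.exp (-t ^ 2 / 2)

theorem smoothRoot_sq (m : ℕ) (a t : ℝ) :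
    smoothRoot m a t ^ 2 = gueWeight (2 * (m : ℝ)) a t := by
  have h : |t - a| ^ (2 * (m : ℝ)) = ((t - a) ^ m) ^ 2 := by
    have h1 : (2 * (m : ℝ)) = ((2 * m : ℕ) : ℝ) := by push_cast; ring
    rw [h1, Real.rpow_natCast, pow_mul, sq_abs, ← pow_mul, ← pow_mul, mul_comm]
  rw [gueWeight, smoothRoot, mul_pow, h, ← Real.exp_nat_mul]
  congr 2
  push_cast
  ring

/-- The correlation kernel of the `N`-point ensemble with weight `|t - a|^{2m} e^{-t²}`, written
with the smooth square root of the weight. -/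
noncomputable def smoothKernel (m : ℕ) (a : ℝ) (N : ℕ) (x y : ℝ) : ℝ :=
  smoothRoot m a x * smoothRoot m a y * polyKernel (gueWeight (2 * (m : ℝ)) a) N x y

/-- The soft-edge length scale `1 / (√2 N^{1/6})`. -/
noncomputable def softScale (N : ℕ) : ℝ := 1 / (Real.sqrt 2 * (N : ℝ) ^ ((1 : ℝ) / 6))

/-- The position `a = √(2N) + c / (√2 N^{1/6})` of the singularity in the soft-edge scaling. -/
noncomputable def softPoint (c : ℝ) (N : ℕ) : ℝ := Real.sqrt (2 * (N : ℝ)) + c * softScale N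

/-- Soft-edge rescaling of a family of kernels `K a N x y`: the singularity `a` is put at
`√(2N) + c / (√2 N^{1/6})`, and `x`, `y` are coordinates relative to it, in units of
`1 / (√2 N^{1/6})`. -/
noncomputable def softRescale (K : ℝ → ℕ → ℝ → ℝ → ℝ) (c x y : ℝ) (N : ℕ) : ℝ :=
  softScale N * K (softPoint c N) N
    (softPoint c N + x * softScale N) (softPoint c N + y * softScale N)

/-- The limiting soft-edge kernel `K^soft_{2m}(x, y; c)`, from the smooth square root of the
weight. -/
noncomputable def softKernel (m : ℕ) (x y c : ℝ) : ℝ :=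
  Filter.limUnder Filter.atTop (softRescale (smoothKernel m) c x y)

/-- The limiting soft-edge kernel for the exponent `μ`, from the nonnegative square root of the
weight. -/
noncomputable def softAbsKernel (μ x y c : ℝ) : ℝ :=
  Filter.limUnder Filter.atTop (softRescale (absKernel μ) c x y)

/-- The quotient `(K(x,y) K(z,z) - K(x,z) K(z,y)) / K(z,z)`. -/
noncomputable def conditionedAt (K : ℝ → ℝ → ℝ) (x y z : ℝ) : ℝ :=
  (K x y * K z z - K x z * K z y) / K z z

/-!
The weight `|t - a|^{2m} e^{-t²}` is `e^{-t²}` multiplied by `(t - a)²` `m` times. Multiplying a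
weight by `(t - a)²` replaces the reproducing kernel `K` of the polynomials of degree at most `n` by
that of the subspace of polynomials vanishing at `a`, which is
`K(x, y) - K(x, a) K(a, y) / K(a, a)`; this is `IsGramSchmidt.kernelPoly_christoffel`. In the Taylor
coefficients of the kernel at `a` it is a Schur complement followed by a shift of both indices
(`kernelCoeff_succ`), so every kernel with a singularity is determined by the coefficients of the
kernel of the Gaussian ensemble, and the recursion of the proposition is the `N → ∞` limit of this
formula. Besides the passage to the limit one needs that the leading coefficient
`K(a, a)` of the reduced kernel does not tend to zero.

The limit of the Gaussian kernel is obtained without the Airy function. The Hermite function `φ_n`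
satisfies `φ'' = (x² - 2n - 1) φ`, which in the edge scaling tends to `u'' = (x + c) u`, and a power
series solution depends continuously on the equation and the initial values
(`DomConv.of_quadODE`). By the Christoffel-Darboux formula the kernel is a function of `φ_n` and
`φ_n'` alone (`kernelCoeff_zero_scaled`). It remains to see that the scaled initial values
`(φ_n, φ_n')` at `√(2n)` converge. The ladder relation and the shift from `√(2n)` to
`√(2n + 2)` express the pair for `n + 1` by a linear map applied to the pair for `n`, which is the
identity up to `O(n^{-4/3})` (`exists_edge_step_bound`). This is summable, so the infinite product of
these maps converges and the limit is not zero (`exists_tendsto_edgeValue`).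

The kernels are positive semidefinite, hence so are their limits. If the leading coefficient of
the `m`-th limit vanished, its first column would vanish, which is a linear relation between columns
of the limiting Gaussian array (`exists_column_combination`). Since that array belongs to
`(u(x) u'(y) - u'(x) u(y)) / (x - y)`, the relation reads `P u = Q u'` with polynomials `P`, `Q` not
both zero (`cdCoeff_columns_independent`), so that `r = P / Q` would be a rational solution of
the Riccati equation `r' + r² = x + c`, which has none by parity of degrees
(`polynomial_relation_trivial`).
-/

open Polynomial Filter Topology

/-! ### Orthogonal polynomials of a positive functional and the Christoffel formula -/

/-- A sequence of polynomials obtained from `1, X, X², …` by the Gram-Schmidt process for the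
bilinear form `(p, q) ↦ Λ (p q)`. -/
def IsGramSchmidt (Λ : ℝ[X] →ₗ[ℝ] ℝ) (p : ℕ → ℝ[X]) : Prop :=
  ∀ n, p n = X ^ n - ∑ j ∈ Finset.range n, C (Λ (X ^ n * p j) / Λ (p j * p j)) * p j

/-- The bilinear form `(p, q) ↦ Λ (p q)` is positive definite. -/
def IsPosFunctional (Λ : ℝ[X] →ₗ[ℝ] ℝ) : Prop := ∀ p : ℝ[X], p ≠ 0 → 0 < Λ (p * p)

/-- The Christoffel-Darboux kernel `∑_{l < n} p_l(x) p_l / Λ(p_l²)` as a polynomial in its second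
variable. -/
noncomputable def kernelPoly (Λ : ℝ[X] →ₗ[ℝ] ℝ) (p : ℕ → ℝ[X]) (n : ℕ) (x : ℝ) : ℝ[X] :=
  ∑ l ∈ Finset.range n, C ((p l).eval x / Λ (p l * p l)) * p l

theorem map_C_mul_eq (Λ : ℝ[X] →ₗ[ℝ] ℝ) (r : ℝ) (p : ℝ[X]) : Λ (C r * p) = r * Λ p := by
  rw [← smul_eq_C_mul, map_smul, smul_eq_mul]

namespace IsGramSchmidt

variable {Λ : ℝ[X] →ₗ[ℝ] ℝ} {p : ℕ → ℝ[X]}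

theorem degree_sub_lt (h : IsGramSchmidt Λ p) (n : ℕ) :
    (p n - X ^ n).degree < (n : WithBot ℕ) ∧ (p n).degree = n := by
  induction n using Nat.strong_induction_on with
  | _ n ih =>
    have h1 : (p n - X ^ n).degree < (n : WithBot ℕ) := by
      rw [h n, sub_sub_cancel_left, degree_neg, ← mem_degreeLT]
      refine Submodule.sum_mem _ fun j hj => ?_
      have hj' := Finset.mem_range.1 hj
      rw [← smul_eq_C_mul]
      refine Submodule.smul_mem _ _ (mem_degreeLT.2 ?_)
      rw [(ih j hj').2]
      exact_mod_cast hj'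
    refine ⟨h1, ?_⟩
    have h2 : p n = X ^ n + (p n - X ^ n) := by ring
    rw [h2, degree_add_eq_left_of_degree_lt, degree_X_pow]
    rwa [degree_X_pow]

theorem ne_zero (h : IsGramSchmidt Λ p) (n : ℕ) : p n ≠ 0 := by
  intro h0
  have := (h.degree_sub_lt n).2
  rw [h0, degree_zero] at this
  exact absurd this (by simp)

theorem orthogonal_lt (h : IsGramSchmidt Λ p) (hΛ : IsPosFunctional Λ) (n : ℕ) :
    ∀ i < n, Λ (p n * p i) = 0 := by
  induction n using Nat.strong_induction_on with
  | _ n ih =>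
    intro i hi
    rw [h n, sub_mul, map_sub, Finset.sum_mul, map_sum, Finset.sum_eq_single i]
    · rw [mul_assoc, map_C_mul_eq, div_mul_cancel₀ _ (hΛ _ (h.ne_zero i)).ne', sub_self]
    · intro j hj hji
      rw [mul_assoc, map_C_mul_eq]
      rcases lt_or_gt_of_ne hji with hlt | hgt
      · rw [mul_comm (p j) (p i), ih i hi j hlt, mul_zero]
      · rw [ih j (Finset.mem_range.1 hj) i hgt, mul_zero]
    · intro hn
      exact absurd (Finset.mem_range.2 hi) hn

theorem orthogonal (h : IsGramSchmidt Λ p) (hΛ : IsPosFunctional Λ) {i j : ℕ} (hij : i ≠ j) :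
    Λ (p i * p j) = 0 := by
  rcases lt_or_gt_of_ne hij with hlt | hgt
  · rw [mul_comm, h.orthogonal_lt hΛ j i hlt]
  · exact h.orthogonal_lt hΛ i j hgt

theorem exists_sum_eq (h : IsGramSchmidt Λ p) (n : ℕ) :
    ∀ q : ℝ[X], q.degree < n → ∃ c : ℕ → ℝ, q = ∑ j ∈ Finset.range n, C (c j) * p j := by
  induction n with
  | zero =>
    intro q hq
    refine ⟨0, ?_⟩
    simpa using hq
  | succ n ih =>
    intro q hq
    have hd : (q - C (q.coeff n) * p n).degree < n := by
      have e : q - C (q.coeff n) * p n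
          = (q - C (q.coeff n) * X ^ n) - C (q.coeff n) * (p n - X ^ n) := by ring
      rw [e, ← mem_degreeLT]
      refine Submodule.sub_mem _ (mem_degreeLT.2 ?_) ?_
      · rw [degree_lt_iff_coeff_zero]
        intro m hm
        rw [coeff_sub, coeff_C_mul, coeff_X_pow]
        rcases hm.eq_or_lt with rfl | hlt
        · simp
        · rw [coeff_eq_zero_of_degree_lt (hq.trans_le (by exact_mod_cast hlt)), if_neg hlt.ne']
          simp
      · rw [← smul_eq_C_mul]
        exact Submodule.smul_mem _ _ (mem_degreeLT.2 (h.degree_sub_lt n).1)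
    obtain ⟨c, hc⟩ := ih _ hd
    refine ⟨fun j => if j = n then q.coeff n else c j, ?_⟩
    rw [Finset.sum_range_succ]
    simp only [if_true]
    have e : ∑ j ∈ Finset.range n, C (if j = n then q.coeff n else c j) * p j
        = ∑ j ∈ Finset.range n, C (c j) * p j :=
      Finset.sum_congr rfl fun j hj => by rw [if_neg (Finset.mem_range.1 hj).ne]
    rw [e, ← hc]
    ring

theorem kernelPoly_reproducing (h : IsGramSchmidt Λ p) (hΛ : IsPosFunctional Λ) (n : ℕ) (x : ℝ)
    {q : ℝ[X]} (hq : q.degree < n) : Λ (kernelPoly Λ p n x * q) = q.eval x := by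
  obtain ⟨c, rfl⟩ := h.exists_sum_eq n q hq
  rw [kernelPoly, Finset.sum_mul, map_sum, eval_finsetSum]
  refine Finset.sum_congr rfl fun l hl => ?_
  rw [Finset.mul_sum, map_sum, Finset.sum_eq_single l]
  · have e : C ((p l).eval x / Λ (p l * p l)) * p l * (C (c l) * p l)
        = C ((p l).eval x / Λ (p l * p l) * c l) * (p l * p l) := by
      rw [C_mul]; ring
    have h0 := (hΛ _ (h.ne_zero l)).ne'
    rw [e, map_C_mul_eq, eval_mul, eval_C]
    field_simp
  · intro j _ hj
    have e : C ((p l).eval x / Λ (p l * p l)) * p l * (C (c j) * p j)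
        = C ((p l).eval x / Λ (p l * p l) * c j) * (p l * p j) := by
      rw [C_mul]; ring
    rw [e, map_C_mul_eq, h.orthogonal hΛ hj.symm, mul_zero]
  · exact fun hn => absurd hl hn

theorem degree_kernelPoly (h : IsGramSchmidt Λ p) (n : ℕ) (x : ℝ) :
    (kernelPoly Λ p n x).degree < n := by
  rw [kernelPoly, ← mem_degreeLT]
  refine Submodule.sum_mem _ fun j hj => ?_
  rw [← smul_eq_C_mul]
  refine Submodule.smul_mem _ _ (mem_degreeLT.2 ?_)
  rw [(h.degree_sub_lt j).2]
  exact_mod_cast Finset.mem_range.1 hj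

theorem kernelPoly_eval_self_pos (h : IsGramSchmidt Λ p) (hΛ : IsPosFunctional Λ) (n : ℕ)
    (x : ℝ) : 0 < (kernelPoly Λ p (n + 1) x).eval x := by
  have h0 : p 0 = 1 := by simpa using h 0
  rw [kernelPoly, eval_finsetSum, Finset.sum_range_succ']
  refine add_pos_of_nonneg_of_pos (Finset.sum_nonneg fun j _ => ?_) ?_
  · rw [eval_mul, eval_C, div_mul_eq_mul_div]
    exact div_nonneg (mul_self_nonneg _) (hΛ _ (h.ne_zero _)).le
  · have := hΛ _ (h.ne_zero 0)
    rw [h0] at this ⊢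
    simpa using this

/-- Multiplying the weight by `(t - a)²` conditions the kernel to vanish at `a`: both sides are
the reproducing kernel of the polynomials of degree at most `n` that vanish at `a`. -/
theorem kernelPoly_christoffel {Λ' : ℝ[X] →ₗ[ℝ] ℝ} {p' : ℕ → ℝ[X]} {a : ℝ}
    (h : IsGramSchmidt Λ p) (hΛ : IsPosFunctional Λ)
    (h' : IsGramSchmidt Λ' p') (hΛ' : IsPosFunctional Λ')
    (hrel : ∀ q, Λ' q = Λ ((X - C a) ^ 2 * q)) (n : ℕ) (x : ℝ) :
    C (x - a) * ((X - C a) * kernelPoly Λ' p' n x) = kernelPoly Λ p (n + 1) x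
      - C ((kernelPoly Λ p (n + 1) x).eval a / (kernelPoly Λ p (n + 1) a).eval a)
        * kernelPoly Λ p (n + 1) a := by
  set K := kernelPoly Λ p (n + 1)
  set K' := kernelPoly Λ' p' n
  have hK : (K a).eval a ≠ 0 := (h.kernelPoly_eval_self_pos hΛ n a).ne'
  set B := K x - C ((K x).eval a / (K a).eval a) * K a with hB
  set A := C (x - a) * ((X - C a) * K' x) with hA
  -- the difference is a multiple `(X - a) r` with `deg r < n`
  have hBa : B.eval a = 0 := by
    rw [hB, eval_sub, eval_mul, eval_C, div_mul_cancel₀ _ hK, sub_self]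
  obtain ⟨b, hb⟩ := dvd_iff_isRoot.2 (show B.IsRoot a from hBa)
  have hBdeg : B.degree < ((n + 1 : ℕ) : WithBot ℕ) := by
    rw [hB, ← mem_degreeLT, ← smul_eq_C_mul]
    exact Submodule.sub_mem _ (mem_degreeLT.2 (h.degree_kernelPoly _ _))
      (Submodule.smul_mem _ _ (mem_degreeLT.2 (h.degree_kernelPoly _ _)))
  have mul_deg : ∀ r : ℝ[X], ((X - C a) * r).degree < ((n + 1 : ℕ) : WithBot ℕ) ↔ r.degree < n := by
    intro r
    rw [degree_mul, degree_X_sub_C]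
    rcases eq_or_ne r 0 with rfl | hr
    · simp
    · rw [degree_eq_natDegree hr]
      norm_cast
      omega
  have hbdeg : b.degree < n := by
    rw [← mul_deg, ← hb]; exact hBdeg
  have repA : ∀ r : ℝ[X], r.degree < n → Λ (A * ((X - C a) * r)) = (x - a) * r.eval x := by
    intro r hr
    have e : A * ((X - C a) * r) = C (x - a) * ((X - C a) ^ 2 * (K' x * r)) := by rw [hA]; ring
    rw [e, map_C_mul_eq, ← hrel, h'.kernelPoly_reproducing hΛ' n x hr]
  have repB : ∀ r : ℝ[X], r.degree < n → Λ (B * ((X - C a) * r)) = (x - a) * r.eval x := by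
    intro r hr
    have hd := (mul_deg r).2 hr
    rw [hB, sub_mul, map_sub, mul_assoc, map_C_mul_eq, h.kernelPoly_reproducing hΛ _ x hd,
      h.kernelPoly_reproducing hΛ _ a hd]
    simp
  set r := C (x - a) * K' x - b with hr
  have hrdeg : r.degree < n := by
    rw [hr, ← mem_degreeLT, ← smul_eq_C_mul]
    exact Submodule.sub_mem _ (Submodule.smul_mem _ _ (mem_degreeLT.2 (h'.degree_kernelPoly _ _)))
      (mem_degreeLT.2 hbdeg)
  have hD : A - B = (X - C a) * r := by rw [hA, hb, hr]; ring
  by_contra hne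
  have hpos := hΛ (A - B) (sub_ne_zero.2 hne)
  have : Λ ((A - B) * (A - B)) = 0 := by
    nth_rewrite 2 [hD]
    rw [sub_mul, map_sub, repA r hrdeg, repB r hrdeg, sub_self]
  exact hpos.ne' this

/-- A monic sequence that is orthogonal to all polynomials of lower degree is the Gram-Schmidt
sequence. -/
theorem eq_of_orthogonal (h : IsGramSchmidt Λ p) (hΛ : IsPosFunctional Λ) {n : ℕ} {q : ℝ[X]}
    (hq : (q - X ^ n).degree < (n : WithBot ℕ)) (horth : ∀ r : ℝ[X], r.degree < n → Λ (q * r) = 0) :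
    p n = q := by
  by_contra hne
  have hdeg : (p n - q).degree < (n : WithBot ℕ) := by
    have e : p n - q = (p n - X ^ n) - (q - X ^ n) := by ring
    rw [e, ← mem_degreeLT]
    exact Submodule.sub_mem _ (mem_degreeLT.2 (h.degree_sub_lt n).1) (mem_degreeLT.2 hq)
  have h1 : Λ (p n * (p n - q)) = 0 := by
    obtain ⟨c, hc⟩ := h.exists_sum_eq n _ hdeg
    rw [hc, Finset.mul_sum, map_sum]
    refine Finset.sum_eq_zero fun j hj => ?_
    rw [mul_left_comm, map_C_mul_eq, h.orthogonal_lt hΛ n j (Finset.mem_range.1 hj), mul_zero]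
  have h2 := horth _ hdeg
  have := hΛ _ (sub_ne_zero.2 hne)
  rw [sub_mul, map_sub, h1, h2, sub_self] at this
  exact this.false

end IsGramSchmidt

/-! ### The weights of the ensemble and the Hermite polynomials -/

theorem gueWeight_eq (m : ℕ) (a t : ℝ) :
    gueWeight (2 * (m : ℝ)) a t = ((X - C a) ^ (2 * m) : ℝ[X]).eval t * Real.exp (-t ^ 2) := by
  rw [← smoothRoot_sq, smoothRoot, mul_pow, ← Real.exp_nat_mul, ← pow_mul]
  simp only [eval_pow, eval_sub, eval_X, eval_C]
  congr 2
  · ring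
  · push_cast; ring

theorem integrable_polynomial_mul_gaussian (p : ℝ[X]) :
    MeasureTheory.Integrable (fun t : ℝ => p.eval t * Real.exp (-t ^ 2)) := by
  induction p using Polynomial.induction_on' with
  | add p q hp hq =>
    simp only [eval_add, add_mul]
    exact hp.add hq
  | monomial n r =>
    simp only [eval_monomial, mul_assoc]
    refine MeasureTheory.Integrable.const_mul ?_ r
    have h := integrable_rpow_mul_exp_neg_mul_sq (b := 1) one_pos (s := n)
      (by have : (0 : ℝ) ≤ n := n.cast_nonneg
          linarith)
    simpa [Real.rpow_natCast] using h

theorem integrable_gueWeight_mul (m : ℕ) (a : ℝ) (p : ℝ[X]) :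
    MeasureTheory.Integrable (fun t : ℝ => gueWeight (2 * (m : ℝ)) a t * p.eval t) := by
  refine (integrable_polynomial_mul_gaussian ((X - C a) ^ (2 * m) * p)).congr
    (Eventually.of_forall fun t => ?_)
  simp only [gueWeight_eq, eval_mul]
  ring

/-- Integration of polynomials against the weight `|t - a|^{2m} e^{-t²}`. -/
noncomputable def gueFunctional (m : ℕ) (a : ℝ) : ℝ[X] →ₗ[ℝ] ℝ where
  toFun p := ∫ t : ℝ, gueWeight (2 * (m : ℝ)) a t * p.eval t
  map_add' p q := by
    simp only [eval_add, mul_add]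
    exact MeasureTheory.integral_add (integrable_gueWeight_mul m a p)
      (integrable_gueWeight_mul m a q)
  map_smul' r p := by
    simp only [eval_smul, smul_eq_mul, RingHom.id_apply]
    rw [← MeasureTheory.integral_const_mul]
    congr 1
    ext t
    ring

theorem gueFunctional_apply (m : ℕ) (a : ℝ) (p : ℝ[X]) :
    gueFunctional m a p = ∫ t : ℝ, gueWeight (2 * (m : ℝ)) a t * p.eval t := rfl

theorem gueFunctional_succ (m : ℕ) (a : ℝ) (q : ℝ[X]) :
    gueFunctional (m + 1) a q = gueFunctional m a ((X - C a) ^ 2 * q) := by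
  rw [gueFunctional_apply, gueFunctional_apply]
  congr 1
  ext t
  rw [gueWeight_eq, gueWeight_eq]
  simp only [eval_pow, eval_sub, eval_X, eval_C, eval_mul]
  ring

theorem isPosFunctional_gueFunctional (m : ℕ) (a : ℝ) : IsPosFunctional (gueFunctional m a) := by
  intro p hp
  set q : ℝ[X] := (X - C a) ^ m * p with hq
  have hq0 : q ≠ 0 := mul_ne_zero (pow_ne_zero _ (X_sub_C_ne_zero a)) hp
  have e : gueFunctional m a (p * p) = ∫ t : ℝ, q.eval t ^ 2 * Real.exp (-t ^ 2) := by
    rw [gueFunctional_apply]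
    congr 1
    ext t
    rw [gueWeight_eq, hq]
    simp only [eval_pow, eval_sub, eval_X, eval_C, eval_mul]
    ring
  obtain ⟨t₀, ht₀⟩ : ∃ t, q.eval t ≠ 0 := by
    by_contra! h
    exact hq0 (Polynomial.funext fun t => by simpa using h t)
  rw [e]
  refine MeasureTheory.integral_pos_of_integrable_nonneg_nonzero (x := t₀) ?_ ?_ ?_ ?_
  · exact (q.continuous.pow 2).mul (by fun_prop)
  · have := integrable_polynomial_mul_gaussian (q ^ 2)
    simpa [eval_pow] using this
  · intro t
    positivity
  · positivity

theorem isGramSchmidt_orthoPoly (m : ℕ) (a : ℝ) :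
    IsGramSchmidt (gueFunctional m a) (orthoPoly (gueWeight (2 * (m : ℝ)) a)) := by
  intro n
  conv_lhs => rw [orthoPoly]
  rw [Finset.sum_range]
  simp only [gueFunctional_apply, eval_mul, eval_pow, eval_X, pow_two]

/-- The monic Hermite polynomials for the weight `e^{-t²}`, defined by their raising operator. -/
noncomputable def monicHermite : ℕ → ℝ[X]
  | 0 => 1
  | n + 1 => X * monicHermite n - C (1 / 2) * derivative (monicHermite n)

theorem derivative_monicHermite (n : ℕ) :
    derivative (monicHermite (n + 1)) = C ((n : ℝ) + 1) * monicHermite n := by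
  induction n with
  | zero => simp [monicHermite]
  | succ n ih =>
    rw [monicHermite, derivative_sub, derivative_mul, derivative_C_mul, derivative_X, ih,
      derivative_C_mul]
    conv_rhs => rw [monicHermite]
    push_cast
    simp only [C_add, C_1]
    rw [monicHermite]
    ring

theorem monicHermite_sub_degree (n : ℕ) :
    (monicHermite n - X ^ n).degree < (n : WithBot ℕ) := by
  induction n with
  | zero => simp [monicHermite]
  | succ n ih =>
    have e : monicHermite (n + 1) - X ^ (n + 1)
        = X * (monicHermite n - X ^ n) - C (1 / 2) * derivative (monicHermite n) := by
      rw [monicHermite]; ring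
    have hd : (monicHermite n).degree ≤ (n : WithBot ℕ) := by
      have : monicHermite n = X ^ n + (monicHermite n - X ^ n) := by ring
      rw [this]
      exact (degree_add_le _ _).trans (max_le (degree_X_pow_le _) ih.le)
    rw [e, ← mem_degreeLT, ← smul_eq_C_mul]
    refine Submodule.sub_mem _ (mem_degreeLT.2 ?_) (Submodule.smul_mem _ _ (mem_degreeLT.2 ?_))
    · rw [degree_lt_iff_coeff_zero] at ih ⊢
      intro k hk
      obtain ⟨k, rfl⟩ : ∃ l, k = l + 1 := ⟨k - 1, by omega⟩
      rw [coeff_X_mul]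
      exact ih k (by omega)
    · refine ((degree_derivative_le).trans hd).trans_lt ?_
      exact_mod_cast n.lt_succ_self

/-- Integration by parts against `e^{-t²}`. -/
theorem gueFunctional_zero_derivative (a : ℝ) (r : ℝ[X]) :
    gueFunctional 0 a (derivative r) = 2 * gueFunctional 0 a (X * r) := by
  have hw : ∀ q : ℝ[X], gueFunctional 0 a q = ∫ t : ℝ, q.eval t * Real.exp (-t ^ 2) := by
    intro q
    rw [gueFunctional_apply]
    congr 1
    ext t
    rw [gueWeight_eq]
    simp [mul_comm]
  have hd : ∀ t : ℝ, HasDerivAt (fun t => r.eval t * Real.exp (-t ^ 2))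
      ((derivative r - C 2 * (X * r)).eval t * Real.exp (-t ^ 2)) t := by
    intro t
    have h1 : HasDerivAt (fun t : ℝ => -t ^ 2) (-(2 * t)) t := by
      exact (hasDerivAt_pow 2 t).neg.congr_deriv (by simp)
    refine ((r.hasDerivAt t).mul h1.exp).congr_deriv ?_
    simp only [eval_sub, eval_mul, eval_C, eval_X]
    ring
  have h := MeasureTheory.integral_eq_zero_of_hasDerivAt_of_integrable hd
    (integrable_polynomial_mul_gaussian _) (integrable_polynomial_mul_gaussian _)
  rw [← hw, map_sub, map_C_mul_eq] at h
  linarith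

theorem gueFunctional_monicHermite_succ (a : ℝ) (n : ℕ) (q : ℝ[X]) :
    gueFunctional 0 a (monicHermite (n + 1) * q)
      = 1 / 2 * gueFunctional 0 a (monicHermite n * derivative q) := by
  have h := gueFunctional_zero_derivative a (monicHermite n * q)
  have e : monicHermite (n + 1) * q = X * (monicHermite n * q)
      - C (1 / 2) * (derivative (monicHermite n) * q) := by
    rw [monicHermite]; ring
  rw [e, map_sub, map_C_mul_eq]
  rw [derivative_mul, map_add] at h
  linarith

theorem gueFunctional_monicHermite_orthogonal (a : ℝ) (n : ℕ) :
    ∀ q : ℝ[X], q.degree < (n : WithBot ℕ) → gueFunctional 0 a (monicHermite n * q) = 0 := by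
  induction n with
  | zero =>
    intro q hq
    have : q = 0 := by simpa using hq
    simp [this]
  | succ n ih =>
    intro q hq
    rw [gueFunctional_monicHermite_succ, ih, mul_zero]
    rw [degree_lt_iff_coeff_zero] at hq ⊢
    intro k hk
    rw [coeff_derivative, hq (k + 1) (by omega), zero_mul]

theorem orthoPoly_gueWeight_zero (a : ℝ) (n : ℕ) :
    orthoPoly (gueWeight (2 * ((0 : ℕ) : ℝ)) a) n = monicHermite n :=
  (isGramSchmidt_orthoPoly 0 a).eq_of_orthogonal (isPosFunctional_gueFunctional 0 a)
    (monicHermite_sub_degree n) (gueFunctional_monicHermite_orthogonal a n)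

theorem monicHermite_ne_zero (n : ℕ) : monicHermite n ≠ 0 := by
  rw [← orthoPoly_gueWeight_zero 0 n]
  exact (isGramSchmidt_orthoPoly 0 0).ne_zero n

/-- The squared norm of the monic Hermite polynomial for the weight `e^{-t²}`. -/
noncomputable def hermiteNorm (n : ℕ) : ℝ :=
  gueFunctional 0 0 (monicHermite n * monicHermite n)

theorem hermiteNorm_pos (n : ℕ) : 0 < hermiteNorm n :=
  isPosFunctional_gueFunctional 0 0 _ (monicHermite_ne_zero n)

theorem gueFunctional_zero_eq (a : ℝ) : gueFunctional 0 a = gueFunctional 0 0 := by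
  ext1 n
  ext
  simp only [gueFunctional_apply, gueWeight_eq, LinearMap.comp_apply]
  simp

theorem hermiteNorm_succ (n : ℕ) : hermiteNorm (n + 1) = ((n : ℝ) + 1) / 2 * hermiteNorm n := by
  rw [hermiteNorm, gueFunctional_monicHermite_succ, derivative_monicHermite, mul_left_comm,
    map_C_mul_eq, hermiteNorm]
  ring

/-! ### Taylor coefficients of the kernels at the singularity -/

/-- The power series `F` converges everywhere on the real line, with sum `f`. -/
def HasSeries (F : PowerSeries ℝ) (f : ℝ → ℝ) : Prop :=
  ∀ x, HasSum (fun i => PowerSeries.coeff i F * x ^ i) (f x)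

theorem HasSeries.mul {F G : PowerSeries ℝ} {f g : ℝ → ℝ} (hF : HasSeries F f)
    (hG : HasSeries G g) : HasSeries (F * G) (fun x => f x * g x) := by
  intro x
  have h1 := (hF x).summable.norm
  have h2 := (hG x).summable.norm
  have e : (fun n => PowerSeries.coeff n (F * G) * x ^ n) = fun n =>
      ∑ kl ∈ Finset.HasAntidiagonal.antidiagonal n,
        (PowerSeries.coeff kl.1 F * x ^ kl.1) * (PowerSeries.coeff kl.2 G * x ^ kl.2) := by
    ext n
    rw [PowerSeries.coeff_mul, Finset.sum_mul]
    refine Finset.sum_congr rfl fun kl hkl => ?_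
    rw [← Finset.HasAntidiagonal.mem_antidiagonal.1 hkl, pow_add]
    ring
  change HasSum _ (f x * g x)
  rw [e, ← (hF x).tsum_eq, ← (hG x).tsum_eq,
    tsum_mul_tsum_eq_tsum_sum_antidiagonal_of_summable_norm h1 h2]
  exact (summable_norm_sum_mul_antidiagonal_of_summable_norm h1 h2).of_norm.hasSum

theorem hasSeries_coe (p : ℝ[X]) : HasSeries (p : PowerSeries ℝ) (fun x => p.eval x) := by
  intro x
  simp only [Polynomial.coeff_coe, eval_eq_sum_range]
  refine hasSum_sum_of_ne_finset_zero fun i hi => ?_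
  rw [coeff_eq_zero_of_natDegree_lt (by simpa using hi), zero_mul]

/-- The Taylor series of `t ↦ e^{-(a + t)²/2}`, as a product of the series of `e^{-a²/2}`,
`e^{-at}` and `e^{-t²/2}`. -/
noncomputable def gaussSeries (a : ℝ) : PowerSeries ℝ :=
  PowerSeries.C (Real.exp (-a ^ 2 / 2)) *
    ((PowerSeries.mk fun i => (-a) ^ i / (i.factorial : ℝ)) *
      PowerSeries.mk fun i => if Even i then (-1 / 2) ^ (i / 2) / ((i / 2).factorial : ℝ) else 0)

theorem hasSeries_gaussSeries (a : ℝ) :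
    HasSeries (gaussSeries a) (fun x => Real.exp (-(a + x) ^ 2 / 2)) := by
  have h0 : HasSeries (PowerSeries.C (Real.exp (-a ^ 2 / 2)))
      (fun _ => Real.exp (-a ^ 2 / 2)) := by
    simpa using hasSeries_coe (C (Real.exp (-a ^ 2 / 2)))
  have h1 : HasSeries (PowerSeries.mk fun i => (-a) ^ i / (i.factorial : ℝ))
      (fun x => Real.exp (-a * x)) := by
    intro x
    rw [Real.exp_eq_exp_ℝ]
    convert! NormedSpace.expSeries_div_hasSum_exp (-a * x) using 2 with i
    rw [PowerSeries.coeff_mk, mul_pow]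
    ring
  have h2 : HasSeries (PowerSeries.mk fun i =>
      if Even i then (-1 / 2) ^ (i / 2) / ((i / 2).factorial : ℝ) else 0)
      (fun x => Real.exp (-x ^ 2 / 2)) := by
    intro x
    change HasSum _ (Real.exp (-x ^ 2 / 2))
    rw [← add_zero (Real.exp (-x ^ 2 / 2))]
    refine HasSum.even_add_odd ?_ ?_
    · rw [Real.exp_eq_exp_ℝ]
      convert! NormedSpace.expSeries_div_hasSum_exp (-x ^ 2 / 2) using 2 with i
      rw [PowerSeries.coeff_mk, if_pos (even_two_mul i), Nat.mul_div_cancel_left i two_pos,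
        pow_mul, div_mul_eq_mul_div, ← mul_pow]
      congr 2
      ring
    · convert! (hasSum_zero (α := ℝ) (β := ℕ)) using 2 with i
      rw [PowerSeries.coeff_mk, if_neg (by simp), zero_mul]
  intro x
  convert! h0.mul (h1.mul h2) x using 1
  simp only [← Real.exp_add]
  congr 1
  ring

theorem derivative_gaussSeries (a : ℝ) : PowerSeries.derivative ℝ (gaussSeries a)
    = -((PowerSeries.C a + PowerSeries.X) * gaussSeries a) := by
  set E₁ : PowerSeries ℝ := PowerSeries.mk fun i => (-a) ^ i / (i.factorial : ℝ) with hE₁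
  set E₂ : PowerSeries ℝ := PowerSeries.mk fun i =>
    if Even i then (-1 / 2) ^ (i / 2) / ((i / 2).factorial : ℝ) else 0 with hE₂
  have h1 : PowerSeries.derivative ℝ E₁ = -(PowerSeries.C a * E₁) := by
    ext n
    rw [PowerSeries.coeff_derivative, map_neg, PowerSeries.coeff_C_mul, hE₁,
      PowerSeries.coeff_mk, PowerSeries.coeff_mk, Nat.factorial_succ]
    have : ((n.factorial : ℕ) : ℝ) ≠ 0 := by exact_mod_cast n.factorial_ne_zero
    have : (n : ℝ) + 1 ≠ 0 := by positivity
    push_cast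
    field_simp
    ring
  have h2 : PowerSeries.derivative ℝ E₂ = -(PowerSeries.X * E₂) := by
    ext n
    rw [PowerSeries.coeff_derivative, map_neg]
    rcases n with _ | n
    · simp [hE₂]
    · rw [PowerSeries.coeff_succ_X_mul, hE₂, PowerSeries.coeff_mk, PowerSeries.coeff_mk]
      by_cases hn : Even n
      · obtain ⟨k, rfl⟩ := hn
        rw [if_pos (by rw [show k + k + 1 + 1 = 2 * (k + 1) by ring]; exact even_two_mul _),
          if_pos ⟨k, rfl⟩, show (k + k + 1 + 1) / 2 = k + 1 by omega,
          show (k + k) / 2 = k by omega, Nat.factorial_succ]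
        have : ((k.factorial : ℕ) : ℝ) ≠ 0 := by exact_mod_cast k.factorial_ne_zero
        have : (k : ℝ) + 1 ≠ 0 := by positivity
        push_cast
        field_simp
        ring
      · rw [if_neg hn, if_neg (by rw [Nat.even_add_one, Nat.even_add_one]; simpa using hn)]
        simp
  rw [gaussSeries, Derivation.leibniz, Derivation.leibniz, h1, h2, PowerSeries.derivative_C]
  simp only [smul_eq_mul]
  ring

/-- The Taylor series of `t ↦ p(a + t) e^{-(a + t)²/2}`. -/
noncomputable def gaussTaylor (a : ℝ) : ℝ[X] →ₗ[ℝ] PowerSeries ℝ where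
  toFun p := (taylor a p : PowerSeries ℝ) * gaussSeries a
  map_add' p q := by simp [add_mul]
  map_smul' r p := by simp

theorem gaussTaylor_apply (a : ℝ) (p : ℝ[X]) :
    gaussTaylor a p = (taylor a p : PowerSeries ℝ) * gaussSeries a := rfl

theorem hasSeries_gaussTaylor (a : ℝ) (p : ℝ[X]) :
    HasSeries (gaussTaylor a p) (fun x => p.eval (a + x) * Real.exp (-(a + x) ^ 2 / 2)) := by
  have h := (hasSeries_coe (taylor a p)).mul (hasSeries_gaussSeries a)
  simp only [taylor_eval, add_comm _ a] at h
  exact h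

theorem gaussTaylor_C_mul (a r : ℝ) (p : ℝ[X]) :
    gaussTaylor a (C r * p) = PowerSeries.C r * gaussTaylor a p := by
  rw [gaussTaylor_apply, gaussTaylor_apply, taylor_mul, taylor_C, Polynomial.coe_mul,
    Polynomial.coe_C, mul_assoc]

theorem gaussTaylor_X_mul (a : ℝ) (p : ℝ[X]) :
    gaussTaylor a (X * p) = (PowerSeries.C a + PowerSeries.X) * gaussTaylor a p := by
  rw [gaussTaylor_apply, gaussTaylor_apply, taylor_mul, taylor_X, Polynomial.coe_mul,
    Polynomial.coe_add, Polynomial.coe_X, Polynomial.coe_C]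
  ring

theorem derivative_gaussTaylor (a : ℝ) (p : ℝ[X]) :
    PowerSeries.derivative ℝ (gaussTaylor a p) = gaussTaylor a (derivative p - X * p) := by
  have h : derivative (taylor a p) = taylor a (derivative p) := by
    rw [taylor_apply, taylor_apply, derivative_comp]
    simp
  rw [map_sub, gaussTaylor_X_mul, gaussTaylor_apply, gaussTaylor_apply, Derivation.leibniz,
    derivative_gaussSeries, PowerSeries.derivative_coe, h]
  simp only [smul_eq_mul]
  ring

theorem gaussTaylor_X_sub_C_mul (a : ℝ) (p : ℝ[X]) :
    gaussTaylor a ((X - C a) * p) = PowerSeries.X * gaussTaylor a p := by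
  rw [sub_mul, map_sub, gaussTaylor_X_mul, gaussTaylor_C_mul]
  ring

theorem coeff_zero_gaussTaylor (a : ℝ) (p : ℝ[X]) :
    PowerSeries.coeff 0 (gaussTaylor a p) = p.eval a * Real.exp (-a ^ 2 / 2) := by
  have h := hasSeries_gaussTaylor a p 0
  have h' := hasSum_single (f := fun i => PowerSeries.coeff i (gaussTaylor a p) * (0 : ℝ) ^ i) 0
    (fun i hi => by simp [hi])
  simpa using h'.unique h

/-- The Taylor coefficients at `(a, a)` of `e^{-X²/2} e^{-Y²/2} ∑_{l < n} p_l(X) p_l(Y) / 𝒩_l`,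
where `p_l` are the orthogonal polynomials of the weight `|t - a|^{2m} e^{-t²}`. -/
noncomputable def kernelCoeff (m : ℕ) (a : ℝ) (n i j : ℕ) : ℝ :=
  ∑ l ∈ Finset.range n,
    PowerSeries.coeff i (gaussTaylor a (orthoPoly (gueWeight (2 * (m : ℝ)) a) l)) *
      PowerSeries.coeff j (gaussTaylor a (orthoPoly (gueWeight (2 * (m : ℝ)) a) l)) /
        gueFunctional m a (orthoPoly (gueWeight (2 * (m : ℝ)) a) l *
          orthoPoly (gueWeight (2 * (m : ℝ)) a) l)

theorem kernelCoeff_symm (m : ℕ) (a : ℝ) (n i j : ℕ) :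
    kernelCoeff m a n i j = kernelCoeff m a n j i :=
  Finset.sum_congr rfl fun l _ => by rw [mul_comm (PowerSeries.coeff i _)]

theorem gueFunctional_orthoPoly_sq_pos (m : ℕ) (a : ℝ) (l : ℕ) :
    0 < gueFunctional m a (orthoPoly (gueWeight (2 * (m : ℝ)) a) l *
          orthoPoly (gueWeight (2 * (m : ℝ)) a) l) :=
  isPosFunctional_gueFunctional m a _ ((isGramSchmidt_orthoPoly m a).ne_zero l)

/-- The Cauchy-Schwarz inequality for the positive semidefinite array of Taylor coefficients. -/
theorem kernelCoeff_sq_le (m : ℕ) (a : ℝ) (n i j : ℕ) :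
    kernelCoeff m a n i j ^ 2 ≤ kernelCoeff m a n i i * kernelCoeff m a n j j := by
  have hN := fun l => gueFunctional_orthoPoly_sq_pos m a l
  have := Finset.sum_mul_sq_le_sq_mul_sq (Finset.range n)
    (fun l => PowerSeries.coeff i (gaussTaylor a (orthoPoly (gueWeight (2 * (m : ℝ)) a) l)) /
      Real.sqrt (gueFunctional m a (orthoPoly (gueWeight (2 * (m : ℝ)) a) l *
          orthoPoly (gueWeight (2 * (m : ℝ)) a) l)))
    (fun l => PowerSeries.coeff j (gaussTaylor a (orthoPoly (gueWeight (2 * (m : ℝ)) a) l)) /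
      Real.sqrt (gueFunctional m a (orthoPoly (gueWeight (2 * (m : ℝ)) a) l *
          orthoPoly (gueWeight (2 * (m : ℝ)) a) l)))
  simp only [div_mul_div_comm, div_pow, Real.mul_self_sqrt (hN _).le, Real.sq_sqrt (hN _).le]
    at this
  simpa only [kernelCoeff, pow_two] using this

theorem kernelPoly_eval_symm (Λ : ℝ[X] →ₗ[ℝ] ℝ) (p : ℕ → ℝ[X]) (n : ℕ) (x y : ℝ) :
    (kernelPoly Λ p n x).eval y = (kernelPoly Λ p n y).eval x := by
  rw [kernelPoly, kernelPoly, eval_finsetSum, eval_finsetSum]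
  refine Finset.sum_congr rfl fun l _ => ?_
  rw [eval_mul, eval_C, eval_mul, eval_C]
  ring

theorem coeff_gaussTaylor_kernelPoly (m : ℕ) (a : ℝ) (n j : ℕ) (x : ℝ) :
    PowerSeries.coeff j (gaussTaylor a (kernelPoly (gueFunctional m a)
      (orthoPoly (gueWeight (2 * (m : ℝ)) a)) n x))
      = ∑ l ∈ Finset.range n, (orthoPoly (gueWeight (2 * (m : ℝ)) a) l).eval x *
      PowerSeries.coeff j (gaussTaylor a (orthoPoly (gueWeight (2 * (m : ℝ)) a) l)) /
        gueFunctional m a (orthoPoly (gueWeight (2 * (m : ℝ)) a) l *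
          orthoPoly (gueWeight (2 * (m : ℝ)) a) l) := by
  rw [kernelPoly, map_sum, map_sum]
  refine Finset.sum_congr rfl fun l _ => ?_
  rw [gaussTaylor_C_mul, PowerSeries.coeff_C_mul]
  ring

theorem kernelCoeff_zero_left (m : ℕ) (a : ℝ) (n j : ℕ) :
    kernelCoeff m a n 0 j = Real.exp (-a ^ 2 / 2) *
      PowerSeries.coeff j (gaussTaylor a (kernelPoly (gueFunctional m a)
        (orthoPoly (gueWeight (2 * (m : ℝ)) a)) n a)) := by
  rw [coeff_gaussTaylor_kernelPoly, kernelCoeff, Finset.mul_sum]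
  refine Finset.sum_congr rfl fun l _ => ?_
  rw [coeff_zero_gaussTaylor]
  ring

theorem kernelCoeff_zero_zero (m : ℕ) (a : ℝ) (n : ℕ) :
    kernelCoeff m a n 0 0 = Real.exp (-a ^ 2 / 2) ^ 2 *
      (kernelPoly (gueFunctional m a) (orthoPoly (gueWeight (2 * (m : ℝ)) a)) n a).eval a := by
  rw [kernelCoeff_zero_left, coeff_zero_gaussTaylor]
  ring

theorem kernelCoeff_zero_zero_pos (m : ℕ) (a : ℝ) (n : ℕ) : 0 < kernelCoeff m a (n + 1) 0 0 := by
  rw [kernelCoeff_zero_zero]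
  have := (isGramSchmidt_orthoPoly m a).kernelPoly_eval_self_pos
    (isPosFunctional_gueFunctional m a) n a
  positivity

/-- The Christoffel formula for the Taylor coefficients: raising the exponent of the weight by
two is a Schur complement followed by a shift of both indices. -/
theorem kernelCoeff_succ (m : ℕ) (a : ℝ) (n i j : ℕ) :
    kernelCoeff (m + 1) a n i j = kernelCoeff m a (n + 1) (i + 1) (j + 1)
      - kernelCoeff m a (n + 1) (i + 1) 0 * kernelCoeff m a (n + 1) 0 (j + 1)
        / kernelCoeff m a (n + 1) 0 0 := by
  set Λ := gueFunctional m a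
  set p := orthoPoly (gueWeight (2 * (m : ℝ)) a) with hp
  set Λ' := gueFunctional (m + 1) a
  set p' := orthoPoly (gueWeight (2 * ((m + 1 : ℕ) : ℝ)) a) with hp'
  set E := Real.exp (-a ^ 2 / 2)
  have hE : E ≠ 0 := Real.exp_ne_zero _
  set κ := (kernelPoly Λ p (n + 1) a).eval a with hκ
  have hκ0 : κ ≠ 0 := ((isGramSchmidt_orthoPoly m a).kernelPoly_eval_self_pos
    (isPosFunctional_gueFunctional m a) n a).ne'
  have hchr := fun x => (isGramSchmidt_orthoPoly m a).kernelPoly_christoffel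
    (isPosFunctional_gueFunctional m a) (isGramSchmidt_orthoPoly (m + 1) a)
    (isPosFunctional_gueFunctional (m + 1) a) (gueFunctional_succ m a) n x
  -- compare coefficients in the second variable
  let D (q : ℕ → ℝ[X]) (Θ : ℝ[X] →ₗ[ℝ] ℝ) (k j : ℕ) : ℝ[X] := ∑ l ∈ Finset.range k,
    C (PowerSeries.coeff j (gaussTaylor a (q l)) / Θ (q l * q l)) * q l
  have hD : ∀ x, (D p Λ (n + 1) (j + 1)).eval x = PowerSeries.coeff (j + 1)
      (gaussTaylor a (kernelPoly Λ p (n + 1) x)) := by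
    intro x
    rw [coeff_gaussTaylor_kernelPoly, eval_finsetSum]
    refine Finset.sum_congr rfl fun l _ => ?_
    rw [eval_mul, eval_C]
    ring
  have hD' : ∀ x, (D p' Λ' n j).eval x = PowerSeries.coeff j
      (gaussTaylor a (kernelPoly Λ' p' n x)) := by
    intro x
    rw [coeff_gaussTaylor_kernelPoly, eval_finsetSum]
    refine Finset.sum_congr rfl fun l _ => ?_
    rw [eval_mul, eval_C]
    ring
  have hpoly : (X - C a) * D p' Λ' n j = D p Λ (n + 1) (j + 1)
      - C (kernelCoeff m a (n + 1) 0 (j + 1) / E / κ) * kernelPoly Λ p (n + 1) a := by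
    refine Polynomial.funext fun x => ?_
    have h := congrArg (fun q => PowerSeries.coeff (j + 1) (gaussTaylor a q)) (hchr x)
    simp only [map_sub (gaussTaylor a), map_sub (PowerSeries.coeff (j + 1)), gaussTaylor_C_mul,
      gaussTaylor_X_sub_C_mul, PowerSeries.coeff_C_mul, PowerSeries.coeff_succ_X_mul] at h
    rw [← hD', ← hD, kernelPoly_eval_symm _ _ _ x a] at h
    simp only [eval_mul, eval_sub, eval_X, eval_C]
    rw [h, kernelCoeff_zero_left, mul_div_cancel_left₀ _ hE]
    ring
  -- and then in the first
  have h := congrArg (fun q => PowerSeries.coeff (i + 1) (gaussTaylor a q)) hpoly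
  simp only [map_sub, gaussTaylor_C_mul, gaussTaylor_X_sub_C_mul, PowerSeries.coeff_C_mul,
      PowerSeries.coeff_succ_X_mul] at h
  have hco : ∀ (m k i j : ℕ), PowerSeries.coeff i (gaussTaylor a
      (∑ l ∈ Finset.range k, C (PowerSeries.coeff j (gaussTaylor a
        (orthoPoly (gueWeight (2 * (m : ℝ)) a) l)) / gueFunctional m a
        (orthoPoly (gueWeight (2 * (m : ℝ)) a) l * orthoPoly (gueWeight (2 * (m : ℝ)) a) l))
          * orthoPoly (gueWeight (2 * (m : ℝ)) a) l)) = kernelCoeff m a k i j := by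
    intro m k i j
    rw [map_sum, map_sum, kernelCoeff]
    refine Finset.sum_congr rfl fun l _ => ?_
    rw [gaussTaylor_C_mul, PowerSeries.coeff_C_mul]
    ring
  have e1 := hco (m + 1) n i j
  have e2 := hco m (n + 1) (i + 1) (j + 1)
  have e3 : PowerSeries.coeff (i + 1) (gaussTaylor a (kernelPoly Λ p (n + 1) a))
      = kernelCoeff m a (n + 1) (i + 1) 0 / E := by
    rw [kernelCoeff_symm, kernelCoeff_zero_left, mul_div_cancel_left₀ _ hE]
  rw [e3] at h
  have e4 : kernelCoeff m a (n + 1) 0 0 = E ^ 2 * κ := kernelCoeff_zero_zero m a (n + 1)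
  refine e1.symm.trans (h.trans ?_)
  rw [e4]
  change PowerSeries.coeff (i + 1) (gaussTaylor a (D p Λ (n + 1) (j + 1))) - _ = _
  rw [show PowerSeries.coeff (i + 1) (gaussTaylor a (D p Λ (n + 1) (j + 1)))
    = kernelCoeff m a (n + 1) (i + 1) (j + 1) from e2]
  field_simp

theorem hasSum_kernelCoeff (m : ℕ) (a : ℝ) (n : ℕ) (x y : ℝ) :
    HasSum (fun ij : ℕ × ℕ => kernelCoeff m a n ij.1 ij.2 * x ^ ij.1 * y ^ ij.2)
      (Real.exp (-(a + x) ^ 2 / 2) * Real.exp (-(a + y) ^ 2 / 2) *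
        polyKernel (gueWeight (2 * (m : ℝ)) a) n (a + x) (a + y)) := by
  rw [polyKernel, Finset.mul_sum]
  simp only [kernelCoeff, Finset.sum_mul]
  refine hasSum_sum fun l _ => ?_
  set q := orthoPoly (gueWeight (2 * (m : ℝ)) a) l with hq
  have h1 := hasSeries_gaussTaylor a q x
  have h2 := hasSeries_gaussTaylor a q y
  have hs := summable_mul_of_summable_norm h1.summable.norm h2.summable.norm
  have h := (h1.mul h2 hs).div_const (gueFunctional m a (q * q))
  convert! h using 1
  · ext ij
    ring
  · have : orthoNorm (gueWeight (2 * (m : ℝ)) a) l = gueFunctional m a (q * q) := by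
      simp only [orthoNorm, gueFunctional_apply, eval_mul, pow_two, hq]
    rw [this]
    ring

/-! ### Hermite functions: ladder relations, differential equation, Christoffel-Darboux formula -/

/-- The normalised Hermite polynomial for the weight `e^{-t²}`. -/
noncomputable def hermitePoly (n : ℕ) : ℝ[X] := C (1 / Real.sqrt (hermiteNorm n)) * monicHermite n

/-- The Hermite function `φ_n`, orthonormal in `L²(ℝ)`. -/
noncomputable def hermiteFun (n : ℕ) (x : ℝ) : ℝ := (hermitePoly n).eval x * Real.exp (-x ^ 2 / 2)

/-- The derivative `φ_n'` of the Hermite function. -/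
noncomputable def hermiteFunDeriv (n : ℕ) (x : ℝ) : ℝ :=
  (derivative (hermitePoly n) - X * hermitePoly n).eval x * Real.exp (-x ^ 2 / 2)

/-- The Taylor series of the Hermite function `φ_n` at `a`. -/
noncomputable def hermiteSeries (a : ℝ) (n : ℕ) : PowerSeries ℝ := gaussTaylor a (hermitePoly n)

theorem sqrt_hermiteNorm_succ (n : ℕ) : Real.sqrt (hermiteNorm (n + 1))
    = Real.sqrt (2 * ((n : ℝ) + 1)) / 2 * Real.sqrt (hermiteNorm n) := by
  rw [hermiteNorm_succ, Real.sqrt_mul (by positivity)]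
  congr 1
  rw [show ((n : ℝ) + 1) / 2 = (2 * ((n : ℝ) + 1)) / 2 ^ 2 by ring,
    Real.sqrt_div (by positivity), Real.sqrt_sq (by norm_num)]

theorem derivative_hermitePoly_succ (n : ℕ) :
    derivative (hermitePoly (n + 1)) = C (Real.sqrt (2 * ((n : ℝ) + 1))) * hermitePoly n := by
  have h1 := Real.sqrt_ne_zero'.2 (hermiteNorm_pos n)
  have h2 : Real.sqrt (2 * ((n : ℝ) + 1)) ≠ 0 := Real.sqrt_ne_zero'.2 (by positivity)
  have h3 := Real.sq_sqrt (show 0 ≤ 2 * ((n : ℝ) + 1) by positivity)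
  rw [hermitePoly, derivative_C_mul, derivative_monicHermite, hermitePoly, ← mul_assoc,
    ← mul_assoc, ← C_mul, ← C_mul, sqrt_hermiteNorm_succ]
  congr 2
  field_simp
  linarith

theorem hermitePoly_raise (n : ℕ) : C (Real.sqrt (2 * ((n : ℝ) + 1))) * hermitePoly (n + 1)
    = C 2 * (X * hermitePoly n) - derivative (hermitePoly n) := by
  have h1 := Real.sqrt_ne_zero'.2 (hermiteNorm_pos n)
  have h2 : Real.sqrt (2 * ((n : ℝ) + 1)) ≠ 0 := Real.sqrt_ne_zero'.2 (by positivity)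
  have e : Real.sqrt (2 * ((n : ℝ) + 1)) * (1 / Real.sqrt (hermiteNorm (n + 1)))
      = 2 * (1 / Real.sqrt (hermiteNorm n)) := by
    rw [sqrt_hermiteNorm_succ]
    field_simp
  rw [hermitePoly, ← mul_assoc, ← C_mul, e, monicHermite, hermitePoly, derivative_C_mul]
  simp only [C_mul]
  have : (C (2 : ℝ)) * C (1 / 2) = 1 := by rw [← C_mul]; norm_num
  linear_combination (-(C (1 / Real.sqrt (hermiteNorm n))) * derivative (monicHermite n)) * this

theorem hermiteSeries_raise (a : ℝ) (n : ℕ) :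
    PowerSeries.C (Real.sqrt (2 * ((n : ℝ) + 1))) * hermiteSeries a (n + 1)
      = (PowerSeries.C a + PowerSeries.X) * hermiteSeries a n
        - PowerSeries.derivative ℝ (hermiteSeries a n) := by
  rw [hermiteSeries, ← gaussTaylor_C_mul, hermitePoly_raise, hermiteSeries,
    derivative_gaussTaylor, ← gaussTaylor_X_mul, ← map_sub]
  congr 1
  have : (C (2 : ℝ)) = 1 + 1 := by rw [← C_1, ← C_add]; norm_num
  rw [this]
  ring

theorem derivative_hermiteSeries_succ (a : ℝ) (n : ℕ) :
    PowerSeries.derivative ℝ (hermiteSeries a (n + 1))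
      = PowerSeries.C (Real.sqrt (2 * ((n : ℝ) + 1))) * hermiteSeries a n
        - (PowerSeries.C a + PowerSeries.X) * hermiteSeries a (n + 1) := by
  rw [hermiteSeries, derivative_gaussTaylor, derivative_hermitePoly_succ, map_sub,
    gaussTaylor_C_mul, gaussTaylor_X_mul, hermiteSeries]

theorem derivative_hermiteSeries_zero (a : ℝ) :
    PowerSeries.derivative ℝ (hermiteSeries a 0)
      = - ((PowerSeries.C a + PowerSeries.X) * hermiteSeries a 0) := by
  rw [hermiteSeries, derivative_gaussTaylor, ← gaussTaylor_X_mul, ← map_neg]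
  congr 1
  simp [hermitePoly, monicHermite]

theorem hermiteSeries_ode (a : ℝ) (n : ℕ) :
    PowerSeries.derivative ℝ (PowerSeries.derivative ℝ (hermiteSeries a n))
      = ((PowerSeries.C a + PowerSeries.X) ^ 2 - PowerSeries.C (2 * (n : ℝ) + 1))
        * hermiteSeries a n := by
  have h1 := hermiteSeries_raise a n
  have h2 := derivative_hermiteSeries_succ a n
  have h3 : PowerSeries.derivative ℝ (hermiteSeries a n)
      = (PowerSeries.C a + PowerSeries.X) * hermiteSeries a n
        - PowerSeries.C (Real.sqrt (2 * ((n : ℝ) + 1))) * hermiteSeries a (n + 1) := by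
    rw [h1]; ring
  have h4 := congrArg (PowerSeries.derivative ℝ) h3
  rw [map_sub, Derivation.leibniz, Derivation.leibniz, map_add, PowerSeries.derivative_C,
    PowerSeries.derivative_C, PowerSeries.derivative_X, h2] at h4
  have h5 : PowerSeries.C (Real.sqrt (2 * ((n : ℝ) + 1))) *
      PowerSeries.C (Real.sqrt (2 * ((n : ℝ) + 1))) = PowerSeries.C (2 * (n : ℝ) + 1) + 1 := by
    rw [← map_mul, Real.mul_self_sqrt (by positivity), ← map_one PowerSeries.C, ← map_add]
    congr 1
    ring
  simp only [smul_eq_mul] at h4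
  rw [h4, h3]
  linear_combination (-hermiteSeries a n) * h5

/-- The coefficients `u` are those of a power series solution of
`u'' = (α + β x + γ x²) u`. -/
structure QuadODE (α β γ : ℝ) (u : ℕ → ℝ) : Prop where
  zero : 2 * u 2 = α * u 0
  one : 6 * u 3 = α * u 1 + β * u 0
  add_two : ∀ i : ℕ, ((i : ℝ) + 4) * ((i : ℝ) + 3) * u (i + 4)
    = α * u (i + 2) + β * u (i + 1) + γ * u i

/-- The Taylor coefficients of `x ↦ φ_n(a + s x) / √(2s)`. -/
noncomputable def scaledHermite (a s : ℝ) (n i : ℕ) : ℝ :=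
  PowerSeries.coeff i (hermiteSeries a n) * s ^ i / Real.sqrt (2 * s)

theorem quadODE_scaledHermite (a s : ℝ) (n : ℕ) :
    QuadODE (s ^ 2 * (a ^ 2 - (2 * n + 1))) (2 * a * s ^ 3) (s ^ 4) (scaledHermite a s n) := by
  have e : ((PowerSeries.C a + PowerSeries.X) ^ 2 - PowerSeries.C (2 * (n : ℝ) + 1))
        * hermiteSeries a n = PowerSeries.C (a ^ 2 - (2 * n + 1)) * hermiteSeries a n
          + PowerSeries.C (2 * a) * (PowerSeries.X * hermiteSeries a n)
          + PowerSeries.X * (PowerSeries.X * hermiteSeries a n) := by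
    rw [map_sub, map_pow, map_mul, show PowerSeries.C (2 : ℝ) = 1 + 1 by
      rw [← map_one PowerSeries.C, ← map_add]; norm_num]
    ring
  have h := fun i => congrArg (PowerSeries.coeff i) ((hermiteSeries_ode a n).trans e)
  simp only [PowerSeries.coeff_derivative, map_add, PowerSeries.coeff_C_mul] at h
  refine ⟨?_, ?_, fun i => ?_⟩
  · have h0 := h 0
    simp only [PowerSeries.coeff_zero_X_mul] at h0
    simp only [scaledHermite]
    push_cast at h0
    linear_combination (s ^ 2 / Real.sqrt (2 * s)) * h0
  · have h0 := h 1
    have hX : ∀ F : PowerSeries ℝ, PowerSeries.coeff 1 (PowerSeries.X * F)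
        = PowerSeries.coeff 0 F := PowerSeries.coeff_succ_X_mul 0
    simp only [hX, PowerSeries.coeff_zero_X_mul] at h0
    simp only [scaledHermite]
    push_cast at h0
    linear_combination (s ^ 3 / Real.sqrt (2 * s)) * h0
  · have h0 := h (i + 2)
    simp only [PowerSeries.coeff_succ_X_mul] at h0
    simp only [scaledHermite]
    push_cast at h0
    linear_combination (s ^ (i + 4) / Real.sqrt (2 * s)) * h0

theorem hasSeries_hermiteSeries (a : ℝ) (n : ℕ) :
    HasSeries (hermiteSeries a n) (fun x => hermiteFun n (a + x)) :=
  hasSeries_gaussTaylor a _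

theorem hasSeries_derivative_hermiteSeries (a : ℝ) (n : ℕ) :
    HasSeries (PowerSeries.derivative ℝ (hermiteSeries a n))
      (fun x => hermiteFunDeriv n (a + x)) := by
  rw [hermiteSeries, derivative_gaussTaylor]
  exact hasSeries_gaussTaylor a _

theorem hasSum_scaledHermite (a s : ℝ) (n : ℕ) (x : ℝ) :
    HasSum (fun i => scaledHermite a s n i * x ^ i)
      (hermiteFun n (a + s * x) / Real.sqrt (2 * s)) := by
  convert! (hasSeries_hermiteSeries a n (s * x)).div_const (Real.sqrt (2 * s)) using 2 with i
  rw [scaledHermite, mul_pow]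
  ring

theorem hasSum_scaledHermite_deriv (a s : ℝ) (n : ℕ) (x : ℝ) :
    HasSum (fun i : ℕ => ((i : ℝ) + 1) * scaledHermite a s n (i + 1) * x ^ i)
      (s * hermiteFunDeriv n (a + s * x) / Real.sqrt (2 * s)) := by
  convert! ((hasSeries_derivative_hermiteSeries a n (s * x)).mul_left s).div_const
    (Real.sqrt (2 * s)) using 2 with i
  rw [scaledHermite, PowerSeries.coeff_derivative, mul_pow]
  ring

theorem coeff_zero_hermiteSeries (a : ℝ) (n : ℕ) :
    PowerSeries.coeff 0 (hermiteSeries a n) = hermiteFun n a :=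
  coeff_zero_gaussTaylor a _

theorem coeff_one_hermiteSeries (a : ℝ) (n : ℕ) :
    PowerSeries.coeff 1 (hermiteSeries a n) = hermiteFunDeriv n a := by
  have h := PowerSeries.coeff_derivative (hermiteSeries a n) 0
  rw [hermiteSeries, derivative_gaussTaylor, coeff_zero_gaussTaylor] at h
  simp only [Nat.cast_zero, zero_add, mul_one] at h
  exact h.symm

theorem scaledHermite_zero (a s : ℝ) (n : ℕ) :
    scaledHermite a s n 0 = hermiteFun n a / Real.sqrt (2 * s) := by
  rw [scaledHermite, coeff_zero_hermiteSeries, pow_zero, mul_one]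

theorem scaledHermite_one (a s : ℝ) (n : ℕ) :
    scaledHermite a s n 1 = s * hermiteFunDeriv n a / Real.sqrt (2 * s) := by
  rw [scaledHermite, coeff_one_hermiteSeries, pow_one, mul_comm s]

theorem hermiteFun_raise (n : ℕ) (x : ℝ) : Real.sqrt (2 * ((n : ℝ) + 1)) * hermiteFun (n + 1) x
    = x * hermiteFun n x - hermiteFunDeriv n x := by
  have h := congrArg (PowerSeries.coeff 0) (hermiteSeries_raise x n)
  simp only [map_sub, add_mul, map_add, PowerSeries.coeff_C_mul, PowerSeries.coeff_zero_X_mul,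
    PowerSeries.coeff_derivative, coeff_zero_hermiteSeries, zero_add, coeff_one_hermiteSeries] at h
  simpa using h

theorem hermiteFunDeriv_succ (n : ℕ) (x : ℝ) : hermiteFunDeriv (n + 1) x
    = Real.sqrt (2 * ((n : ℝ) + 1)) * hermiteFun n x - x * hermiteFun (n + 1) x := by
  have h := congrArg (PowerSeries.coeff 0) (derivative_hermiteSeries_succ x n)
  simp only [map_sub, add_mul, map_add, PowerSeries.coeff_C_mul, PowerSeries.coeff_zero_X_mul,
    PowerSeries.coeff_derivative, coeff_zero_hermiteSeries, zero_add, coeff_one_hermiteSeries] at h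
  simpa using h

/-- A Hermite function has no double zero: the ladder relations would carry it down to `φ_0`. -/
theorem hermiteFun_ne_zero_or (n : ℕ) (x : ℝ) : hermiteFun n x ≠ 0 ∨ hermiteFunDeriv n x ≠ 0 := by
  by_contra! h
  induction n with
  | zero =>
    have h1 := h.1
    simp only [hermiteFun, hermitePoly, monicHermite] at h1
    have := Real.sqrt_ne_zero'.2 (hermiteNorm_pos 0)
    simp [this, Real.exp_ne_zero] at h1
  | succ n ih =>
    have hr : Real.sqrt (2 * ((n : ℝ) + 1)) ≠ 0 := Real.sqrt_ne_zero'.2 (by positivity)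
    have h1 := hermiteFunDeriv_succ n x
    rw [h.1, h.2, mul_zero, sub_zero] at h1
    have h0 : hermiteFun n x = 0 := by
      rcases mul_eq_zero.1 h1.symm with h | h
      · exact absurd h hr
      · exact h
    have h2 := hermiteFun_raise n x
    rw [h.1, h0] at h2
    exact ih ⟨h0, by linarith⟩

theorem kernelCoeff_zero_eq (a : ℝ) (n i j : ℕ) : kernelCoeff 0 a n i j
    = ∑ l ∈ Finset.range n, PowerSeries.coeff i (hermiteSeries a l) *
        PowerSeries.coeff j (hermiteSeries a l) := by
  rw [kernelCoeff]
  refine Finset.sum_congr rfl fun l _ => ?_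
  have h1 := Real.sqrt_ne_zero'.2 (hermiteNorm_pos l)
  have h2 := Real.sq_sqrt (hermiteNorm_pos l).le
  simp only [hermiteSeries, hermitePoly, gaussTaylor_C_mul, PowerSeries.coeff_C_mul,
    orthoPoly_gueWeight_zero]
  rw [gueFunctional_zero_eq, ← hermiteNorm]
  nth_rewrite 1 [← h2]
  field_simp

/-- The Christoffel-Darboux formula
`(x - y) K_n(x, y) = ½ (φ(x) φ'(y) - φ'(x) φ(y)) - ½ (x - y) φ(x) φ(y)`, `φ = φ_n`,
in terms of Taylor coefficients at `a`. -/
theorem hermiteSeries_christoffel_darboux (a : ℝ) (n i j : ℕ) :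
    ∑ l ∈ Finset.range n,
      (PowerSeries.coeff i (PowerSeries.X * hermiteSeries a l) *
          PowerSeries.coeff j (hermiteSeries a l)
        - PowerSeries.coeff i (hermiteSeries a l) *
          PowerSeries.coeff j (PowerSeries.X * hermiteSeries a l))
    = (PowerSeries.coeff i (hermiteSeries a n) *
          PowerSeries.coeff j (PowerSeries.derivative ℝ (hermiteSeries a n))
        - PowerSeries.coeff i (PowerSeries.derivative ℝ (hermiteSeries a n)) *
          PowerSeries.coeff j (hermiteSeries a n)) / 2
      - (PowerSeries.coeff i (PowerSeries.X * hermiteSeries a n) *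
          PowerSeries.coeff j (hermiteSeries a n)
        - PowerSeries.coeff i (hermiteSeries a n) *
          PowerSeries.coeff j (PowerSeries.X * hermiteSeries a n)) / 2 := by
  induction n with
  | zero =>
    rw [derivative_hermiteSeries_zero, Finset.sum_range_zero]
    simp only [map_neg, add_mul, map_add, PowerSeries.coeff_C_mul]
    ring
  | succ n ih =>
    rw [Finset.sum_range_succ, ih, derivative_hermiteSeries_succ]
    have h := fun k => congrArg (PowerSeries.coeff k) (hermiteSeries_raise a n)
    simp only [map_sub, add_mul, map_add, PowerSeries.coeff_C_mul] at h ⊢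
    linear_combination (PowerSeries.coeff i (hermiteSeries a n) * h j
      - PowerSeries.coeff j (hermiteSeries a n) * h i) / 2

/-- The array with `A_{i, j+1} - A_{i+1, j} = D_{i+1, j+1}` and `A_{i, 0} = D_{i+1, 0}`, where `D`
is the coefficient array of `u(x) u'(y) - u'(x) u(y) - t (x - y) u(x) u(y)`. It is the coefficient
array of the quotient of that function by `x - y`. -/
noncomputable def cdCoeff (t : ℝ) (u : ℕ → ℝ) : ℕ → ℕ → ℝ
  | i, 0 => u (i + 1) * u 1 - ((i : ℝ) + 2) * u (i + 2) * u 0 - t * (u i * u 0)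
  | i, j + 1 => cdCoeff t u (i + 1) j
      + (u (i + 1) * (((j : ℝ) + 2) * u (j + 2)) - ((i : ℝ) + 2) * u (i + 2) * u (j + 1))
      - t * (u i * u (j + 1) - u (i + 1) * u j)

theorem kernelCoeff_zero_scaled (a : ℝ) {s : ℝ} (hs : 0 < s) (n i j : ℕ) :
    s * s ^ (i + j) * kernelCoeff 0 a n i j = cdCoeff (s ^ 2) (scaledHermite a s n) i j := by
  have h2 : Real.sqrt (2 * s) ≠ 0 := Real.sqrt_ne_zero'.2 (by positivity)
  have h3 := Real.sq_sqrt (show 0 ≤ 2 * s by positivity)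
  induction j generalizing i with
  | zero =>
    have h := hermiteSeries_christoffel_darboux a n (i + 1) 0
    simp only [PowerSeries.coeff_succ_X_mul, PowerSeries.coeff_zero_X_mul, mul_zero, sub_zero,
      PowerSeries.coeff_derivative, zero_add] at h
    rw [kernelCoeff_zero_eq, h, cdCoeff]
    simp only [scaledHermite]
    generalize Real.sqrt (2 * s) = q at h2 h3
    field_simp
    rw [h3]
    push_cast
    ring
  | succ j ih =>
    have h := hermiteSeries_christoffel_darboux a n (i + 1) (j + 1)
    simp only [PowerSeries.coeff_succ_X_mul, PowerSeries.coeff_derivative] at h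
    rw [Finset.sum_sub_distrib, ← kernelCoeff_zero_eq, ← kernelCoeff_zero_eq] at h
    rw [cdCoeff, ← ih (i + 1), sub_eq_iff_eq_add.1 h]
    simp only [scaledHermite]
    generalize Real.sqrt (2 * s) = q at h2 h3
    field_simp
    rw [h3]
    push_cast
    ring

/-! ### Dominated convergence of power series coefficients -/

/-- Dominated convergence of the coefficients of entire power series: convergence of each
coefficient, together with a bound `C r^i` for every `r > 0` that is uniform along the filter. -/
structure DomConv {ι : Type*} (l : Filter ι) (u : ι → ℕ → ℝ) (v : ℕ → ℝ) : Prop where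
  tendsto : ∀ i, Tendsto (fun N => u N i) l (𝓝 (v i))
  bound : ∀ r : ℝ, 0 < r → ∃ C, 0 ≤ C ∧ ∀ᶠ N in l, ∀ i, |u N i| ≤ C * r ^ i

/-- Dominated convergence of the coefficients of entire power series in two variables. -/
structure DomConv₂ {ι : Type*} (l : Filter ι) (A : ι → ℕ → ℕ → ℝ) (B : ℕ → ℕ → ℝ) : Prop where
  tendsto : ∀ i j, Tendsto (fun N => A N i j) l (𝓝 (B i j))
  bound : ∀ r : ℝ, 0 < r → ∃ C, 0 ≤ C ∧ ∀ᶠ N in l, ∀ i j, |A N i j| ≤ C * r ^ (i + j)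

section

variable {ι : Type*} {l : Filter ι}

theorem DomConv₂.of_eq {u : ι → ℕ → ℕ → ℝ} {v : ℕ → ℕ → ℝ} (h : DomConv₂ l u v) [l.NeBot]
    {κ : Type*} (l' : Filter κ) : DomConv₂ l' (fun _ => v) v where
  tendsto _ _ := tendsto_const_nhds
  bound r hr := by
    obtain ⟨C, hC, hb⟩ := h.bound r hr
    exact ⟨C, hC, Eventually.of_forall fun _ i j =>
      le_of_tendsto (h.tendsto i j).abs (hb.mono fun N hN => hN i j)⟩

theorem DomConv₂.congr' {A A' : ι → ℕ → ℕ → ℝ} {B : ℕ → ℕ → ℝ} (h : DomConv₂ l A B)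
    (he : A =ᶠ[l] A') : DomConv₂ l A' B where
  tendsto i j := (h.tendsto i j).congr' (he.mono fun N hN => by rw [hN])
  bound r hr := by
    obtain ⟨C, hC, hb⟩ := h.bound r hr
    refine ⟨C, hC, ?_⟩
    filter_upwards [hb, he] with N h1 h2
    rwa [← h2]

theorem DomConv.deriv {u : ι → ℕ → ℝ} {v : ℕ → ℝ} (h : DomConv l u v) :
    DomConv l (fun N i => ((i : ℝ) + 1) * u N (i + 1)) (fun i => ((i : ℝ) + 1) * v (i + 1)) where
  tendsto i := (h.tendsto (i + 1)).const_mul _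
  bound r hr := by
    obtain ⟨C, hC, hb⟩ := h.bound (r / 2) (by positivity)
    refine ⟨C * r, by positivity, hb.mono fun N hN i => ?_⟩
    have h2 : ((i : ℝ) + 1) ≤ 2 ^ (i + 1) := by
      have := (i + 1).lt_two_pow_self.le
      exact_mod_cast this
    rw [abs_mul, abs_of_nonneg (show (0 : ℝ) ≤ i + 1 by positivity)]
    calc ((i : ℝ) + 1) * |u N (i + 1)| ≤ 2 ^ (i + 1) * (C * (r / 2) ^ (i + 1)) :=
          mul_le_mul h2 (hN _) (abs_nonneg _) (by positivity)
      _ = C * r * r ^ i := by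
          rw [div_pow]
          field_simp
          ring

theorem eventually_abs_le_add_one {x₀ : ℝ} {x : ι → ℝ} (hx : Tendsto x l (𝓝 x₀)) :
    ∀ᶠ N in l, |x N| ≤ |x₀| + 1 :=
  (hx.abs.eventually_lt_const (lt_add_one _)).mono fun _ h => h.le

theorem half_pow_bound {R C t y : ℝ} (hR : 0 < R) (k : ℕ) (ht : |t| ≤ C * (1 / (2 * R)) ^ k)
    (hy : |y| ≤ R ^ k) (hC : 0 ≤ C) : |t * y| ≤ C * (1 / 2) ^ k := by
  rw [abs_mul]
  calc |t| * |y| ≤ C * (1 / (2 * R)) ^ k * R ^ k :=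
        mul_le_mul ht hy (abs_nonneg _) (by positivity)
    _ = C * (1 / 2) ^ k := by
        rw [mul_assoc, ← mul_pow]
        congr 2
        field_simp

theorem DomConv.tendsto_tsum {u : ι → ℕ → ℝ} {v : ℕ → ℝ} (h : DomConv l u v) {x₀ : ℝ}
    {x : ι → ℝ} (hx : Tendsto x l (𝓝 x₀)) :
    Tendsto (fun N => ∑' i, u N i * x N ^ i) l (𝓝 (∑' i, v i * x₀ ^ i)) := by
  set R := |x₀| + 1 with hR
  have hR0 : 0 < R := by positivity
  obtain ⟨C, hC, hb⟩ := h.bound (1 / (2 * R)) (by positivity)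
  refine tendsto_tsum_of_dominated_convergence (bound := fun i => C * (1 / 2) ^ i)
    (summable_geometric_two.mul_left C) (fun i => (h.tendsto i).mul (hx.pow i)) ?_
  filter_upwards [hb, eventually_abs_le_add_one hx] with N h1 h2 i
  refine half_pow_bound hR0 i (h1 i) ?_ hC
  rw [abs_pow]
  exact pow_le_pow_left₀ (abs_nonneg _) h2 i

theorem summable_half_pow_add : Summable fun ij : ℕ × ℕ => (1 / 2 : ℝ) ^ (ij.1 + ij.2) := by
  have h := summable_geometric_two
  refine (h.mul_of_nonneg h (fun i => by positivity) (fun i => by positivity)).congr fun ij => ?_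
  rw [pow_add]

theorem abs_pow_mul_pow_le {x y R : ℝ} (hx : |x| ≤ R) (hy : |y| ≤ R) (i j : ℕ) :
    |x ^ i * y ^ j| ≤ R ^ (i + j) := by
  rw [abs_mul, abs_pow, abs_pow, pow_add]
  have hR := (abs_nonneg x).trans hx
  gcongr

theorem DomConv₂.summable {A : ι → ℕ → ℕ → ℝ} {B : ℕ → ℕ → ℝ} (h : DomConv₂ l A B) [l.NeBot]
    (x y : ℝ) : Summable fun ij : ℕ × ℕ => B ij.1 ij.2 * x ^ ij.1 * y ^ ij.2 := by
  obtain ⟨C, hC, hb⟩ := (h.of_eq (⊤ : Filter ℕ)).bound (1 / (2 * (|x| + |y| + 1)))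
    (by positivity)
  obtain ⟨_, hb⟩ := hb.exists
  refine Summable.of_norm_bounded (summable_half_pow_add.mul_left C) fun ij => ?_
  rw [mul_assoc]
  exact half_pow_bound (by positivity) _ (hb ij.1 ij.2) (abs_pow_mul_pow_le
    (by linarith [abs_nonneg y]) (by linarith [abs_nonneg x]) _ _) hC

theorem DomConv₂.tendsto_tsum {A : ι → ℕ → ℕ → ℝ} {B : ℕ → ℕ → ℝ} (h : DomConv₂ l A B)
    {x₀ y₀ : ℝ} {x y : ι → ℝ} (hx : Tendsto x l (𝓝 x₀)) (hy : Tendsto y l (𝓝 y₀)) :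
    Tendsto (fun N => ∑' ij : ℕ × ℕ, A N ij.1 ij.2 * x N ^ ij.1 * y N ^ ij.2) l
      (𝓝 (∑' ij : ℕ × ℕ, B ij.1 ij.2 * x₀ ^ ij.1 * y₀ ^ ij.2)) := by
  set R := |x₀| + |y₀| + 1 with hR
  have hR0 : 0 < R := by positivity
  obtain ⟨C, hC, hb⟩ := h.bound (1 / (2 * R)) (by positivity)
  refine tendsto_tsum_of_dominated_convergence (bound := fun ij => C * (1 / 2) ^ (ij.1 + ij.2))
    (summable_half_pow_add.mul_left C)
    (fun ij => ((h.tendsto ij.1 ij.2).mul (hx.pow _)).mul (hy.pow _)) ?_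
  filter_upwards [hb, eventually_abs_le_add_one hx, eventually_abs_le_add_one hy] with N h1 h2 h3 ij
  rw [mul_assoc]
  exact half_pow_bound hR0 _ (h1 ij.1 ij.2) (abs_pow_mul_pow_le
    (by linarith [abs_nonneg y₀]) (by linarith [abs_nonneg x₀]) _ _) hC

/-- Solutions of `u'' = (α + β x + γ x²) u` depend continuously on the coefficients of the
equation and on the initial values. -/
theorem DomConv.of_quadODE {α β γ : ι → ℝ} {α₀ β₀ γ₀ : ℝ} {u : ι → ℕ → ℝ} {v : ℕ → ℝ}
    (hα : Tendsto α l (𝓝 α₀)) (hβ : Tendsto β l (𝓝 β₀)) (hγ : Tendsto γ l (𝓝 γ₀))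
    (hu : ∀ᶠ N in l, QuadODE (α N) (β N) (γ N) (u N)) (hv : QuadODE α₀ β₀ γ₀ v)
    (h0 : Tendsto (fun N => u N 0) l (𝓝 (v 0))) (h1 : Tendsto (fun N => u N 1) l (𝓝 (v 1))) :
    DomConv l u v := by
  have ht : ∀ i, Tendsto (fun N => u N i) l (𝓝 (v i)) := by
    intro i
    induction i using Nat.strong_induction_on with
    | _ i ih =>
      rcases i with _ | _ | _ | _ | i
      · exact h0
      · exact h1
      · rw [show v 2 = α₀ * v 0 / 2 by linarith [hv.zero]]
        refine ((hα.mul h0).div_const 2).congr' (hu.mono fun N hN => ?_)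
        linarith [hN.zero]
      · rw [show v 3 = (α₀ * v 1 + β₀ * v 0) / 6 by linarith [hv.one]]
        refine (((hα.mul h1).add (hβ.mul h0)).div_const 6).congr' (hu.mono fun N hN => ?_)
        linarith [hN.one]
      · have hne : ((i : ℝ) + 4) * ((i : ℝ) + 3) ≠ 0 := by positivity
        rw [show v (i + 4) = (α₀ * v (i + 2) + β₀ * v (i + 1) + γ₀ * v i)
          / (((i : ℝ) + 4) * ((i : ℝ) + 3)) by rw [eq_div_iff hne]; linarith [hv.add_two i]]
        refine ((((hα.mul (ih (i + 2) (by omega))).add (hβ.mul (ih (i + 1) (by omega)))).add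
          (hγ.mul (ih i (by omega)))).div_const _).congr' (hu.mono fun N hN => ?_)
        rw [div_eq_iff hne]
        linarith [hN.add_two i]
  refine ⟨ht, fun r hr => ?_⟩
  set b := |α₀| + |β₀| + |γ₀| + 1 with hb
  -- beyond the index `k` the recursion cannot violate the bound `C r^i`
  obtain ⟨k, hk⟩ := exists_nat_ge ((b * r ^ 2 + b * r + b) / r ^ 4)
  set C := ∑ i ∈ Finset.range (k + 4), (|v i| + 1) / r ^ i with hCdef
  have hC0 : 0 ≤ C := Finset.sum_nonneg fun i _ => by positivity
  refine ⟨C, hC0, ?_⟩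
  have hinit : ∀ᶠ N in l, ∀ i ∈ Finset.range (k + 4), |u N i| ≤ C * r ^ i := by
    rw [Filter.eventually_all_finset]
    intro i hi
    filter_upwards [(ht i).abs.eventually_lt_const (lt_add_one _)] with N hN
    have h1 : (|v i| + 1) / r ^ i ≤ C := Finset.single_le_sum
      (f := fun i => (|v i| + 1) / r ^ i) (fun i _ => by positivity) hi
    rw [div_le_iff₀ (by positivity)] at h1
    linarith
  have hα' : ∀ᶠ N in l, |α N| ≤ b := (hα.abs.eventually_lt_const
    (show |α₀| < b by linarith [abs_nonneg β₀, abs_nonneg γ₀])).mono fun _ h => h.le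
  have hβ' : ∀ᶠ N in l, |β N| ≤ b := (hβ.abs.eventually_lt_const
    (show |β₀| < b by linarith [abs_nonneg α₀, abs_nonneg γ₀])).mono fun _ h => h.le
  have hγ' : ∀ᶠ N in l, |γ N| ≤ b := (hγ.abs.eventually_lt_const
    (show |γ₀| < b by linarith [abs_nonneg β₀, abs_nonneg α₀])).mono fun _ h => h.le
  filter_upwards [hinit, hα', hβ', hγ', hu] with N hN ha hb' hc hode i
  have hb0 : 0 ≤ b := by positivity
  induction i using Nat.strong_induction_on with
  | _ i ih =>
    by_cases hi : i < k + 4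
    · exact hN i (Finset.mem_range.2 hi)
    · obtain ⟨j, rfl⟩ : ∃ j, i = j + 4 := ⟨i - 4, by omega⟩
      have hjk : (k : ℝ) ≤ j := by exact_mod_cast (show k ≤ j by omega)
      have hpos : (0 : ℝ) < ((j : ℝ) + 4) * ((j : ℝ) + 3) := by positivity
      have hstep : ((j : ℝ) + 4) * ((j : ℝ) + 3) * |u N (j + 4)|
          ≤ C * r ^ j * (b * r ^ 2 + b * r + b) := by
        rw [← abs_of_pos hpos, ← abs_mul, hode.add_two j]
        refine (abs_add_three _ _ _).trans ?_
        rw [abs_mul, abs_mul, abs_mul]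
        have e1 := mul_le_mul ha (ih (j + 2) (by omega)) (abs_nonneg _) hb0
        have e2 := mul_le_mul hb' (ih (j + 1) (by omega)) (abs_nonneg _) hb0
        have e3 := mul_le_mul hc (ih j (by omega)) (abs_nonneg _) hb0
        refine (add_le_add (add_le_add e1 e2) e3).trans (le_of_eq ?_)
        ring
      have hbig : b * r ^ 2 + b * r + b ≤ ((j : ℝ) + 4) * ((j : ℝ) + 3) * r ^ 4 := by
        rw [← div_le_iff₀ (by positivity)]
        refine hk.trans (hjk.trans ?_)
        nlinarith [j.cast_nonneg (α := ℝ)]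
      have := hstep.trans (mul_le_mul_of_nonneg_left hbig (by positivity))
      rw [show C * r ^ j * (((j : ℝ) + 4) * ((j : ℝ) + 3) * r ^ 4)
        = ((j : ℝ) + 4) * ((j : ℝ) + 3) * (C * r ^ (j + 4)) by ring] at this
      exact le_of_mul_le_mul_left this hpos

theorem DomConv.cdCoeff {t : ι → ℝ} {u : ι → ℕ → ℝ} {v : ℕ → ℝ} (h : DomConv l u v)
    (ht : Tendsto t l (𝓝 0)) : DomConv₂ l (fun N => cdCoeff (t N) (u N)) (cdCoeff 0 v) where
  tendsto i j := by
    induction j generalizing i with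
    | zero =>
      simp only [_root_.cdCoeff]
      exact (((h.tendsto _).mul (h.tendsto _)).sub (((h.tendsto _).const_mul _).mul
        (h.tendsto _))).sub (ht.mul ((h.tendsto _).mul (h.tendsto _)))
    | succ j ih =>
      simp only [_root_.cdCoeff]
      exact ((ih (i + 1)).add (((h.tendsto _).mul ((h.tendsto _).const_mul _)).sub
        (((h.tendsto _).const_mul _).mul (h.tendsto _)))).sub
        (ht.mul (((h.tendsto _).mul (h.tendsto _)).sub ((h.tendsto _).mul (h.tendsto _))))
  bound r hr := by
    set ρ := r / 2 with hρ
    have hρ0 : 0 < ρ := by positivity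
    obtain ⟨C₁, hC₁, hb₁⟩ := h.bound ρ hρ0
    obtain ⟨C₂, hC₂, hb₂⟩ := h.deriv.bound ρ hρ0
    have ht1 : ∀ᶠ N in l, |t N| ≤ 1 := by
      have := ht.abs
      rw [abs_zero] at this
      exact (this.eventually_lt_const one_pos).mono fun _ h => h.le
    set K := 2 * (C₁ * C₂) * ρ + 2 * (C₁ * C₁)
    refine ⟨K, by positivity, ?_⟩
    filter_upwards [hb₁, hb₂, ht1] with N h1 h2 h3
    have hw : ∀ i : ℕ, |((i : ℝ) + 2) * u N (i + 2)| ≤ C₂ * ρ ^ (i + 1) := by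
      intro i
      have := h2 (i + 1)
      push_cast at this
      rwa [add_assoc, one_add_one_eq_two] at this
    have key : ∀ j i, |_root_.cdCoeff (t N) (u N) i j| ≤ ((j : ℝ) + 1) * (K * ρ ^ (i + j)) := by
      intro j
      induction j with
      | zero =>
        intro i
        rw [_root_.cdCoeff]
        have a1 : |u N (i + 1) * u N 1| ≤ C₁ * ρ ^ (i + 1) * (C₂ * ρ ^ 0) := by
          rw [abs_mul]
          have := h2 0
          simp only [Nat.cast_zero, zero_add, one_mul] at this
          exact mul_le_mul (h1 _) this (abs_nonneg _) (by positivity)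
        have a2 : |((i : ℝ) + 2) * u N (i + 2) * u N 0| ≤ C₂ * ρ ^ (i + 1) * (C₁ * ρ ^ 0) := by
          rw [abs_mul]
          exact mul_le_mul (hw _) (h1 _) (abs_nonneg _) (by positivity)
        have a3 : |t N * (u N i * u N 0)| ≤ 1 * (C₁ * ρ ^ i * (C₁ * ρ ^ 0)) := by
          rw [abs_mul, abs_mul]
          exact mul_le_mul h3 (mul_le_mul (h1 _) (h1 _) (abs_nonneg _) (by positivity))
            (by positivity) zero_le_one
        have a4 := (abs_sub _ _).trans (add_le_add ((abs_sub _ _).trans (add_le_add a1 a2)) a3)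
        refine a4.trans ?_
        have : 0 ≤ C₁ * C₁ * ρ ^ i := by positivity
        rw [pow_succ, pow_zero, add_zero, Nat.cast_zero]
        simp only [K]
        linarith
      | succ j ih =>
        intro i
        rw [_root_.cdCoeff]
        have a0 := ih (i + 1)
        have a1 : |u N (i + 1) * (((j : ℝ) + 2) * u N (j + 2))|
            ≤ C₁ * ρ ^ (i + 1) * (C₂ * ρ ^ (j + 1)) := by
          rw [abs_mul]
          exact mul_le_mul (h1 _) (hw _) (abs_nonneg _) (by positivity)
        have a2 : |((i : ℝ) + 2) * u N (i + 2) * u N (j + 1)|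
            ≤ C₂ * ρ ^ (i + 1) * (C₁ * ρ ^ (j + 1)) := by
          rw [abs_mul]
          exact mul_le_mul (hw _) (h1 _) (abs_nonneg _) (by positivity)
        have a3 : |u N i * u N (j + 1)| ≤ C₁ * ρ ^ i * (C₁ * ρ ^ (j + 1)) := by
          rw [abs_mul]
          exact mul_le_mul (h1 _) (h1 _) (abs_nonneg _) (by positivity)
        have a4 : |u N (i + 1) * u N j| ≤ C₁ * ρ ^ (i + 1) * (C₁ * ρ ^ j) := by
          rw [abs_mul]
          exact mul_le_mul (h1 _) (h1 _) (abs_nonneg _) (by positivity)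
        have a5 : |t N * (u N i * u N (j + 1) - u N (i + 1) * u N j)|
            ≤ 1 * (C₁ * ρ ^ i * (C₁ * ρ ^ (j + 1)) + C₁ * ρ ^ (i + 1) * (C₁ * ρ ^ j)) := by
          rw [abs_mul]
          exact mul_le_mul h3 ((abs_sub _ _).trans (add_le_add a3 a4)) (abs_nonneg _) zero_le_one
        have a6 := (abs_sub _ _).trans (add_le_add ((abs_add_le _ _).trans
          (add_le_add a0 ((abs_sub _ _).trans (add_le_add a1 a2)))) a5)
        refine a6.trans (le_of_eq ?_)
        simp only [K]
        push_cast
        ring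
    intro i j
    refine (key j i).trans ?_
    have h2j : ((j : ℝ) + 1) ≤ 2 ^ j := by
      have := (Nat.succ_le_iff).2 j.lt_two_pow_self
      exact_mod_cast this
    have h2i : (1 : ℝ) ≤ 2 ^ i := one_le_pow₀ one_le_two
    calc ((j : ℝ) + 1) * (K * ρ ^ (i + j)) ≤ (2 ^ i * 2 ^ j) * (K * ρ ^ (i + j)) := by
          refine mul_le_mul_of_nonneg_right ?_ (by positivity)
          nlinarith
      _ = K * r ^ (i + j) := by
          rw [← pow_add, hρ, div_pow]
          field_simp

end

/-! ### One step of the recursion for the Hermite functions at the edge -/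

/-- A sequence whose relative increments are summable converges to a nonzero limit. -/
theorem exists_tendsto_ne_zero_of_relative_increments {E : Type*} [NormedAddCommGroup E]
    [CompleteSpace E] {V : ℕ → E} {e : ℕ → ℝ} (he0 : ∀ n, 0 ≤ e n) (he : Summable e) (n₀ : ℕ)
    (hV : ∀ n ≥ n₀, V n ≠ 0) (hstep : ∀ n ≥ n₀, ‖V (n + 1) - V n‖ ≤ e n * ‖V n‖) :
    ∃ L : E, L ≠ 0 ∧ Tendsto V atTop (𝓝 L) := by
  obtain ⟨n₁, hn₁, htail⟩ : ∃ n₁ ≥ n₀, ∀ k, ∑ i ∈ Finset.range k, e (n₁ + i) ≤ 1 / 4 := by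
    have h := (tendsto_sum_nat_add e).eventually_lt_const (show (0 : ℝ) < 1 / 4 by norm_num)
    obtain ⟨n₁, h1, h2⟩ := (h.and (eventually_ge_atTop n₀)).exists
    refine ⟨n₁, h2, fun k => ?_⟩
    have hs := (summable_nat_add_iff n₁).2 he
    refine (Finset.sum_congr rfl fun i _ => ?_).trans_le
      ((hs.sum_le_tsum (Finset.range k) fun i _ => he0 _).trans h1.le)
    rw [add_comm]
  set M := ‖V n₁‖ with hM
  have hM0 : 0 < M := norm_pos_iff.2 (hV n₁ hn₁)
  have key : ∀ k, ‖V (n₁ + k) - V n₁‖ ≤ 3 / 2 * M * ∑ i ∈ Finset.range k, e (n₁ + i) := by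
    intro k
    induction k with
    | zero => simp
    | succ k ih =>
      have hk : ‖V (n₁ + k)‖ ≤ 3 / 2 * M := by
        have h1 : ‖V (n₁ + k)‖ ≤ ‖V (n₁ + k) - V n₁‖ + M := by
          simpa using norm_add_le (V (n₁ + k) - V n₁) (V n₁)
        have h2 := mul_le_mul_of_nonneg_left (htail k) (show 0 ≤ 3 / 2 * M by positivity)
        linarith
      have h3 := hstep (n₁ + k) (by omega)
      have h4 := mul_le_mul_of_nonneg_left hk (he0 (n₁ + k))
      have h5 : ‖V (n₁ + (k + 1)) - V n₁‖
          ≤ ‖V (n₁ + k + 1) - V (n₁ + k)‖ + ‖V (n₁ + k) - V n₁‖ := by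
        simpa [add_assoc] using norm_sub_le_norm_sub_add_norm_sub (V (n₁ + k + 1)) (V (n₁ + k))
          (V n₁)
      rw [Finset.sum_range_succ]
      linarith
  have hhalf : ∀ k, ‖V (n₁ + k) - V n₁‖ ≤ 1 / 2 * M := fun k => by
    have h2 := mul_le_mul_of_nonneg_left (htail k) (show 0 ≤ 3 / 2 * M by positivity)
    linarith [key k]
  have hbd : ∀ k, ‖V (n₁ + k)‖ ≤ 3 / 2 * M := fun k => by
    have h1 : ‖V (n₁ + k)‖ ≤ ‖V (n₁ + k) - V n₁‖ + M := by
      simpa using norm_add_le (V (n₁ + k) - V n₁) (V n₁)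
    linarith [hhalf k]
  have hcau : CauchySeq fun k => V (n₁ + k) := by
    refine cauchySeq_of_summable_dist (Summable.of_nonneg_of_le (fun _ => dist_nonneg)
      (fun k => ?_) (((summable_nat_add_iff n₁).2 he).mul_left (3 / 2 * M)))
    rw [dist_comm, dist_eq_norm]
    have h3 := hstep (n₁ + k) (by omega)
    have h4 := mul_le_mul_of_nonneg_left (hbd k) (he0 (n₁ + k))
    rw [add_comm k n₁, mul_comm]
    exact h3.trans h4
  obtain ⟨L, hL⟩ := cauchySeq_tendsto_of_complete hcau
  refine ⟨L, ?_, ?_⟩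
  · rintro rfl
    have h := le_of_tendsto' (hL.sub_const (V n₁)).norm hhalf
    rw [zero_sub, norm_neg] at h
    linarith
  · refine (tendsto_add_atTop_iff_nat n₁).1 ?_
    simpa only [add_comm] using hL

theorem QuadODE.abs_le {α β γ M : ℝ} {u : ℕ → ℝ} (h : QuadODE α β γ u) (hα : |α| ≤ 3 / 2)
    (hβ : |β| ≤ 1) (hγ : |γ| ≤ 1) (h0 : |u 0| ≤ M) (h1 : |u 1| ≤ M) (i : ℕ) : |u i| ≤ M := by
  have hM : 0 ≤ M := (abs_nonneg _).trans h0
  induction i using Nat.strong_induction_on with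
  | _ i ih =>
    rcases i with _ | _ | _ | _ | i
    · exact h0
    · exact h1
    · have e := congrArg abs h.zero
      rw [abs_mul, abs_mul, abs_two] at e
      have := mul_le_mul hα h0 (abs_nonneg _) (by norm_num)
      change |u 2| ≤ M
      linarith
    · have e := congrArg abs h.one
      rw [abs_mul, abs_of_pos (by norm_num : (0 : ℝ) < 6)] at e
      have e2 := abs_add_le (α * u 1) (β * u 0)
      rw [abs_mul, abs_mul] at e2
      have := mul_le_mul hα h1 (abs_nonneg _) (by norm_num)
      have := mul_le_mul hβ h0 (abs_nonneg _) (by norm_num)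
      change |u 3| ≤ M
      linarith
    · have e := congrArg abs (h.add_two i)
      have hpos : (12 : ℝ) ≤ ((i : ℝ) + 4) * ((i : ℝ) + 3) := by
        nlinarith [i.cast_nonneg (α := ℝ)]
      rw [abs_mul, abs_of_pos (by linarith : (0 : ℝ) < ((i : ℝ) + 4) * ((i : ℝ) + 3))] at e
      have e2 := abs_add_three (α * u (i + 2)) (β * u (i + 1)) (γ * u i)
      rw [abs_mul, abs_mul, abs_mul] at e2
      have := mul_le_mul hα (ih (i + 2) (by omega)) (abs_nonneg _) (by norm_num)
      have := mul_le_mul hβ (ih (i + 1) (by omega)) (abs_nonneg _) (by norm_num)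
      have := mul_le_mul hγ (ih i (by omega)) (abs_nonneg _) (by norm_num)
      have := mul_le_mul_of_nonneg_right hpos (abs_nonneg (u (i + 4)))
      change |u (i + 4)| ≤ M
      linarith

/-- Taylor remainder of order four for a power series whose coefficients grow at most linearly. -/
theorem abs_tsum_sub_four_terms_le {w : ℕ → ℝ} {M δ ε : ℝ} (hw : ∀ i, |w i| ≤ ((i : ℝ) + 1) * M)
    (hδ0 : 0 ≤ δ) (hδε : δ ≤ ε) (hδ : δ ≤ 1 / 2) :
    |∑' i, w i * δ ^ i - (w 0 + w 1 * δ + w 2 * δ ^ 2 + w 3 * δ ^ 3)|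
      ≤ (∑' i : ℕ, ((i : ℝ) + 5) * (1 / 2) ^ i) * M * ε ^ 4 := by
  have hM : 0 ≤ M := by
    have := (abs_nonneg _).trans (hw 0)
    simpa using this
  have hsum5 : Summable fun i : ℕ => ((i : ℝ) + 5) * (1 / 2 : ℝ) ^ i := by
    have h1 := summable_pow_mul_geometric_of_norm_lt_one 1
      (show ‖(1 / 2 : ℝ)‖ < 1 by norm_num)
    refine (h1.add (summable_geometric_two.mul_left 5)).congr fun i => ?_
    ring
  have hbd : ∀ i, ‖w (i + 4) * δ ^ (i + 4)‖ ≤ ((i : ℝ) + 5) * (1 / 2) ^ i * (M * ε ^ 4) := by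
    intro i
    rw [norm_mul, Real.norm_eq_abs, Real.norm_eq_abs, abs_of_nonneg (pow_nonneg hδ0 _), pow_add]
    have h1 := hw (i + 4)
    push_cast at h1
    have h2 : δ ^ i ≤ (1 / 2) ^ i := pow_le_pow_left₀ hδ0 hδ i
    have h3 : δ ^ 4 ≤ ε ^ 4 := pow_le_pow_left₀ hδ0 hδε 4
    calc |w (i + 4)| * (δ ^ i * δ ^ 4) ≤ (((i : ℝ) + 4 + 1) * M) * ((1 / 2) ^ i * ε ^ 4) := by
          gcongr
      _ = ((i : ℝ) + 5) * (1 / 2) ^ i * (M * ε ^ 4) := by ring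
  have hs4 : Summable fun i => w (i + 4) * δ ^ (i + 4) :=
    Summable.of_norm_bounded (hsum5.mul_right _) hbd
  have hs : Summable fun i => w i * δ ^ i := (summable_nat_add_iff 4).1 hs4
  rw [← hs.sum_add_tsum_nat_add 4]
  simp only [Finset.sum_range_succ, Finset.sum_range_zero, zero_add, pow_zero, mul_one, pow_one,
    add_sub_cancel_left]
  have := tsum_of_norm_bounded (hsum5.mul_right (M * ε ^ 4)).hasSum hbd
  rw [tsum_mul_right] at this
  rw [Real.norm_eq_abs] at this
  linarith

/-- `f(ε) = 1 + x ε³ + O(ε⁴)` uniformly on `[0, 1]`. -/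
def CubicExpansion (f : ℝ → ℝ) (x : ℝ) : Prop :=
  ∃ C, 0 ≤ C ∧ ∀ ε, 0 ≤ ε → ε ≤ 1 → |f ε - 1 - x * ε ^ 3| ≤ C * ε ^ 4

theorem CubicExpansion.abs_le {f : ℝ → ℝ} {x : ℝ} (h : CubicExpansion f x) :
    ∃ B, 0 ≤ B ∧ ∀ ε, 0 ≤ ε → ε ≤ 1 → |f ε| ≤ B := by
  obtain ⟨C, hC, h⟩ := h
  refine ⟨C + 1 + |x|, by positivity, fun ε h0 h1 => ?_⟩
  have e1 := h ε h0 h1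
  have e2 : C * ε ^ 4 ≤ C := mul_le_of_le_one_right hC (pow_le_one₀ h0 h1)
  have e3 : |x * ε ^ 3| ≤ |x| := by
    rw [abs_mul, abs_of_nonneg (pow_nonneg h0 3)]
    exact mul_le_of_le_one_right (abs_nonneg _) (pow_le_one₀ h0 h1)
  have e4 : f ε = (f ε - 1 - x * ε ^ 3) + 1 + x * ε ^ 3 := by ring
  rw [e4]
  refine (abs_add_three _ _ _).trans ?_
  rw [abs_one]
  linarith

theorem CubicExpansion.mul {f g : ℝ → ℝ} {x y : ℝ} (hf : CubicExpansion f x)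
    (hg : CubicExpansion g y) : CubicExpansion (fun ε => f ε * g ε) (x + y) := by
  obtain ⟨B, hB, hgB⟩ := hg.abs_le
  obtain ⟨C, hC, hf⟩ := hf
  obtain ⟨D, hD, hg⟩ := hg
  refine ⟨C * B + (1 + |x|) * D + |x * y|, by positivity, fun ε h0 h1 => ?_⟩
  have e : f ε * g ε - 1 - (x + y) * ε ^ 3 = (f ε - 1 - x * ε ^ 3) * g ε
      + (1 + x * ε ^ 3) * (g ε - 1 - y * ε ^ 3) + x * y * ε ^ 6 := by ring
  rw [e]
  refine (abs_add_three _ _ _).trans ?_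
  rw [abs_mul, abs_mul, abs_mul (x * y), abs_of_nonneg (pow_nonneg h0 6)]
  have e1 := mul_le_mul (hf ε h0 h1) (hgB ε h0 h1) (abs_nonneg _) (by positivity)
  have e2 : |1 + x * ε ^ 3| ≤ 1 + |x| := by
    refine (abs_add_le _ _).trans ?_
    rw [abs_one, abs_mul, abs_of_nonneg (pow_nonneg h0 3)]
    linarith [mul_le_of_le_one_right (abs_nonneg x) (pow_le_one₀ h0 h1 (n := 3))]
  have e3 := mul_le_mul e2 (hg ε h0 h1) (abs_nonneg _) (by positivity)
  have e4 : |x * y| * ε ^ 6 ≤ |x * y| * ε ^ 4 :=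
    mul_le_mul_of_nonneg_left (pow_le_pow_of_le_one h0 h1 (by norm_num)) (abs_nonneg _)
  linarith

theorem CubicExpansion.inv {f : ℝ → ℝ} {x : ℝ} (hf : CubicExpansion f x)
    (h1f : ∀ ε, 0 ≤ ε → 1 ≤ f ε) : CubicExpansion (fun ε => (f ε)⁻¹) (-x) := by
  obtain ⟨C, hC, hf⟩ := hf
  refine ⟨(1 + |x|) * C + |x * x|, by positivity, fun ε h0 h1 => ?_⟩
  have hpos : 0 < f ε := one_pos.trans_le (h1f ε h0)
  have e : (f ε)⁻¹ - 1 - -x * ε ^ 3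
      = (f ε)⁻¹ * (-(1 - x * ε ^ 3) * (f ε - 1 - x * ε ^ 3) + x * x * ε ^ 6) := by
    field_simp
    ring
  rw [e, abs_mul, abs_of_pos (inv_pos.2 hpos)]
  have e2 : |-(1 - x * ε ^ 3)| ≤ 1 + |x| := by
    rw [abs_neg]
    refine (abs_sub _ _).trans ?_
    rw [abs_one, abs_mul, abs_of_nonneg (pow_nonneg h0 3)]
    linarith [mul_le_of_le_one_right (abs_nonneg x) (pow_le_one₀ h0 h1 (n := 3))]
  have e3 := mul_le_mul e2 (hf ε h0 h1) (abs_nonneg _) (by positivity)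
  have e4 : |x * x| * ε ^ 6 ≤ |x * x| * ε ^ 4 :=
    mul_le_mul_of_nonneg_left (pow_le_pow_of_le_one h0 h1 (by norm_num)) (abs_nonneg _)
  refine (mul_le_of_le_one_left (abs_nonneg _) (inv_le_one_of_one_le₀ (h1f ε h0))).trans ?_
  refine (abs_add_le _ _).trans ?_
  rw [abs_mul, abs_mul (x * x), abs_of_nonneg (pow_nonneg h0 6)]
  linarith

theorem cubicExpansion_rpow_twelfth :
    CubicExpansion (fun ε => (1 + ε ^ 3) ^ ((1 : ℝ) / 12)) (1 / 12) := by
  refine ⟨4083, by norm_num, fun ε h0 h1 => ?_⟩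
  set x := ε ^ 3 with hx
  have hx0 : 0 ≤ x := pow_nonneg h0 3
  have hx1 : x ≤ 1 := pow_le_one₀ h0 h1
  set κ := (1 + x) ^ ((1 : ℝ) / 12) with hκ
  have h12 : κ ^ 12 = 1 + x := by
    rw [hκ, ← Real.rpow_natCast, ← Real.rpow_mul (by positivity)]
    norm_num
  have hκ1 : 1 ≤ κ := Real.one_le_rpow (by linarith) (by norm_num)
  obtain ⟨y, hy⟩ : ∃ y, κ = 1 + y := ⟨κ - 1, by ring⟩
  have hy0 : 0 ≤ y := by linarith
  have hyx : 12 * y ≤ x := by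
    have := one_add_mul_le_pow (show (-2 : ℝ) ≤ y by linarith) 12
    rw [← hy, h12] at this
    push_cast at this
    linarith
  have hy1 : y ≤ 1 := by linarith
  have hexp : x ≤ 12 * y + 4083 * y ^ 2 := by
    have hp : ∀ k : ℕ, y ^ (k + 2) ≤ y ^ 2 := fun k =>
      pow_le_pow_of_le_one hy0 hy1 (by omega)
    have e : x = (1 + y) ^ 12 - 1 := by rw [← hy, h12]; ring
    rw [e]
    have := hp 1; have := hp 2; have := hp 3; have := hp 4; have := hp 5; have := hp 6
    have := hp 7; have := hp 8; have := hp 9; have := hp 10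
    ring_nf at *
    linarith
  have hx2 : y ^ 2 ≤ ε ^ 4 := by
    have hyx' : y ≤ x := by linarith
    calc y ^ 2 ≤ x ^ 2 := pow_le_pow_left₀ hy0 hyx' 2
      _ = ε ^ 6 := by rw [hx]; ring
      _ ≤ ε ^ 4 := pow_le_pow_of_le_one h0 h1 (by norm_num)
  change |κ - 1 - 1 / 12 * x| ≤ 4083 * ε ^ 4
  rw [hy, abs_le]
  constructor <;> nlinarith [sq_nonneg y]

theorem cubicExpansion_sqrt : CubicExpansion (fun ε => Real.sqrt (1 + ε ^ 3)) (1 / 2) := by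
  refine ⟨1, by norm_num, fun ε h0 h1 => ?_⟩
  set x := ε ^ 3 with hx
  have hx0 : 0 ≤ x := pow_nonneg h0 3
  have h2 := Real.sq_sqrt (show 0 ≤ 1 + x by linarith)
  have hσ : 1 ≤ Real.sqrt (1 + x) := Real.one_le_sqrt.2 (by linarith)
  set σ := Real.sqrt (1 + x)
  have hx2 : x ^ 2 ≤ ε ^ 4 := by
    calc x ^ 2 = ε ^ 6 := by rw [hx]; ring
      _ ≤ ε ^ 4 := pow_le_pow_of_le_one h0 h1 (by norm_num)
  have hσx : σ - 1 ≤ x := by nlinarith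
  change |σ - 1 - 1 / 2 * x| ≤ 1 * ε ^ 4
  rw [abs_le]
  constructor <;> nlinarith [sq_nonneg (σ - 1)]

/-- The shift `(√(2n + 2) - √(2n)) / s_n` of the edge, in units of the edge scale
`s_n = 1 / (√2 n^{1/6})`, as a function of `ε = n^{-1/3}`. -/
noncomputable def edgeShift (ε : ℝ) : ℝ := 2 * ε / (Real.sqrt (1 + ε ^ 3) + 1)

theorem edgeShift_eq {ε : ℝ} (h0 : 0 ≤ ε) :
    ∃ a, 0 ≤ a ∧ a ≤ 1 ∧ edgeShift ε = ε * (1 - ε ^ 3 * a) := by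
  set x := ε ^ 3 with hx
  have hx0 : 0 ≤ x := pow_nonneg h0 3
  have h2 := Real.sq_sqrt (show 0 ≤ 1 + x by linarith)
  have hσ : 1 ≤ Real.sqrt (1 + x) := Real.one_le_sqrt.2 (by linarith)
  rw [edgeShift, ← hx]
  set σ := Real.sqrt (1 + x)
  refine ⟨1 / (σ + 1) ^ 2, by positivity, ?_, ?_⟩
  · rw [div_le_one (by positivity)]
    nlinarith
  · have : x = (σ - 1) * (σ + 1) := by linarith
    have h3 : σ + 1 ≠ 0 := by positivity
    rw [this]
    field_simp
    ring

theorem exists_bound_unit_square {F : ℝ × ℝ → ℝ} (hF : Continuous F) :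
    ∃ C, 0 ≤ C ∧ ∀ ε a : ℝ, 0 ≤ ε → ε ≤ 1 → 0 ≤ a → a ≤ 1 → |F (ε, a)| ≤ C := by
  obtain ⟨C, hC⟩ := (isCompact_Icc.prod isCompact_Icc : IsCompact
    (Set.Icc (0 : ℝ) 1 ×ˢ Set.Icc (0 : ℝ) 1)).exists_bound_of_continuousOn hF.continuousOn
  have h : ∀ ε a : ℝ, 0 ≤ ε → ε ≤ 1 → 0 ≤ a → a ≤ 1 → |F (ε, a)| ≤ C :=
    fun ε a h1 h2 h3 h4 => hC (ε, a) ⟨⟨h1, h2⟩, ⟨h3, h4⟩⟩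
  exact ⟨C, (abs_nonneg _).trans (h 0 0 le_rfl zero_le_one le_rfl zero_le_one), h⟩

theorem cubicExpansion_of_edgeShift {f : ℝ → ℝ} {x : ℝ} {F : ℝ × ℝ → ℝ} (hF : Continuous F)
    (h : ∀ ε a, edgeShift ε = ε * (1 - ε ^ 3 * a) → f ε = 1 + x * ε ^ 3 + ε ^ 4 * F (ε, a)) :
    CubicExpansion f x := by
  obtain ⟨C, hC, hb⟩ := exists_bound_unit_square hF
  refine ⟨C, hC, fun ε h0 h1 => ?_⟩
  obtain ⟨a, ha0, ha1, ha⟩ := edgeShift_eq h0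
  rw [h ε a ha, show 1 + x * ε ^ 3 + ε ^ 4 * F (ε, a) - 1 - x * ε ^ 3 = F (ε, a) * ε ^ 4 by ring,
    abs_mul, abs_of_nonneg (pow_nonneg h0 4)]
  exact mul_le_mul_of_nonneg_right (hb ε a h0 h1 ha0 ha1) (pow_nonneg h0 4)

theorem CubicExpansion.of_sub {f : ℝ → ℝ} (h : CubicExpansion (fun ε => 1 + f ε) 0) :
    ∃ C, 0 ≤ C ∧ ∀ ε, 0 ≤ ε → ε ≤ 1 → |f ε| ≤ C * ε ^ 4 := by
  obtain ⟨C, hC, h⟩ := h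
  exact ⟨C, hC, fun ε h0 h1 => by simpa using h ε h0 h1⟩

/-- One step `n → n + 1` of the initial values at the edge, with `ε = n^{-1/3}`. The ladder
relation at `√(2n)` and the shift of the base point by `edgeShift ε` cancel to first order, and the
terms of order `ε³` cancel against the change of normalisation; the increment is `O(ε⁴)`. -/
theorem exists_edge_step_bound : ∃ C, 0 ≤ C ∧ ∀ (ε p q : ℝ) (u : ℕ → ℝ), 0 ≤ ε → ε ≤ 1 / 2 →
    QuadODE (-3 / 2 * ε) 1 (ε ^ 2 / 4) u →
    u 0 = (Real.sqrt (1 + ε ^ 3))⁻¹ * (p - ε * q) →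
    u 1 = (Real.sqrt (1 + ε ^ 3))⁻¹ * (q + ε ^ 2 * p) →
    |(1 + ε ^ 3) ^ ((1 : ℝ) / 12) * ∑' i, u i * edgeShift ε ^ i - p|
      ≤ C * ε ^ 4 * (|p| + |q|) ∧
    |((1 + ε ^ 3) ^ ((1 : ℝ) / 12))⁻¹ *
        ∑' i : ℕ, ((i : ℝ) + 1) * u (i + 1) * edgeShift ε ^ i - q|
      ≤ C * ε ^ 4 * (|p| + |q|) := by
  set σ' : ℝ → ℝ := fun ε => (Real.sqrt (1 + ε ^ 3))⁻¹ with hσ'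
  set κ : ℝ → ℝ := fun ε => (1 + ε ^ 3) ^ ((1 : ℝ) / 12) with hκ
  set κ' : ℝ → ℝ := fun ε => (κ ε)⁻¹ with hκ'
  have one_le_sqrt : ∀ ε : ℝ, 0 ≤ ε → 1 ≤ Real.sqrt (1 + ε ^ 3) := fun ε h0 =>
    Real.one_le_sqrt.2 (by linarith [pow_nonneg h0 3])
  have one_le_κ : ∀ ε : ℝ, 0 ≤ ε → 1 ≤ κ ε := fun ε h0 =>
    Real.one_le_rpow (by linarith [pow_nonneg h0 3]) (by norm_num)
  have Eσ : CubicExpansion σ' (-(1 / 2)) := cubicExpansion_sqrt.inv one_le_sqrt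
  have Eκ : CubicExpansion κ (1 / 12) := cubicExpansion_rpow_twelfth
  have Eκ' : CubicExpansion κ' (-(1 / 12)) := Eκ.inv one_le_κ
  -- the entries of the transfer matrix, truncated after the cubic terms in the shift `δ`
  let b11 : ℝ → ℝ := fun ε => 1 + ε ^ 2 * edgeShift ε - 3 / 4 * ε * edgeShift ε ^ 2
    + (1 - 3 / 2 * ε ^ 3) / 6 * edgeShift ε ^ 3
  let b12 : ℝ → ℝ := fun ε => -ε + edgeShift ε + 3 / 4 * ε ^ 2 * edgeShift ε ^ 2
    - 5 / 12 * ε * edgeShift ε ^ 3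
  let b21 : ℝ → ℝ := fun ε => ε ^ 2 - 3 / 2 * ε * edgeShift ε
    + (1 - 3 / 2 * ε ^ 3) / 2 * edgeShift ε ^ 2 + 19 / 24 * ε ^ 2 * edgeShift ε ^ 3
  let b22 : ℝ → ℝ := fun ε => 1 + 3 / 2 * ε ^ 2 * edgeShift ε - 5 / 4 * ε * edgeShift ε ^ 2
    + (1 / 3 - 11 / 24 * ε ^ 3) * edgeShift ε ^ 3
  have E11 : CubicExpansion b11 (5 / 12) := by
    refine cubicExpansion_of_edgeShift (F := fun z => -(z.1 ^ 2 * z.2) *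
      ((1 - z.1 ^ 3 * z.2) ^ 2 / 6 - 7 / 12 * (1 - z.1 ^ 3 * z.2) + 5 / 12)
        - z.1 ^ 2 * (1 - z.1 ^ 3 * z.2) ^ 3 / 4) (by fun_prop) fun ε a h => ?_
    simp only [b11, h]
    ring
  have E12 : CubicExpansion (fun ε => 1 + b12 ε) 0 := by
    refine cubicExpansion_of_edgeShift (F := fun z => -z.2 + 3 / 4 * (1 - z.1 ^ 3 * z.2) ^ 2
      - 5 / 12 * (1 - z.1 ^ 3 * z.2) ^ 3) (by fun_prop) fun ε a h => ?_
    simp only [b12, h]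
    ring
  have E21 : CubicExpansion (fun ε => 1 + b21 ε) 0 := by
    refine cubicExpansion_of_edgeShift (F := fun z => z.1 * z.2 * (1 - (1 - z.1 ^ 3 * z.2) / 2)
      - 3 / 4 * z.1 * (1 - z.1 ^ 3 * z.2) ^ 2 + 19 / 24 * z.1 * (1 - z.1 ^ 3 * z.2) ^ 3)
      (by fun_prop) fun ε a h => ?_
    simp only [b21, h]
    ring
  have E22 : CubicExpansion b22 (7 / 12) := by
    refine cubicExpansion_of_edgeShift (F := fun z => -(z.1 ^ 2 * z.2) *
      ((1 - z.1 ^ 3 * z.2) ^ 2 / 3 - 11 / 12 * (1 - z.1 ^ 3 * z.2) + 7 / 12)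
        - 11 / 24 * z.1 ^ 2 * (1 - z.1 ^ 3 * z.2) ^ 3) (by fun_prop) fun ε a h => ?_
    simp only [b22, h]
    ring
  obtain ⟨C11, hC11, M11⟩ : ∃ C, 0 ≤ C ∧ ∀ ε, 0 ≤ ε → ε ≤ 1 →
      |κ ε * σ' ε * b11 ε - 1| ≤ C * ε ^ 4 := by
    obtain ⟨C, hC, h⟩ := (Eκ.mul Eσ).mul E11
    exact ⟨C, hC, fun ε h0 h1 => by have := h ε h0 h1; norm_num at this; exact this⟩
  obtain ⟨C22, hC22, M22⟩ : ∃ C, 0 ≤ C ∧ ∀ ε, 0 ≤ ε → ε ≤ 1 →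
      |κ' ε * σ' ε * b22 ε - 1| ≤ C * ε ^ 4 := by
    obtain ⟨C, hC, h⟩ := (Eκ'.mul Eσ).mul E22
    exact ⟨C, hC, fun ε h0 h1 => by have := h ε h0 h1; norm_num at this; exact this⟩
  obtain ⟨C12, hC12, M12⟩ := E12.of_sub
  obtain ⟨C21, hC21, M21⟩ := E21.of_sub
  obtain ⟨K, hK, hκK⟩ := Eκ.abs_le
  set S := ∑' i : ℕ, ((i : ℝ) + 5) * (1 / 2 : ℝ) ^ i with hS
  have hS0 : 0 ≤ S := tsum_nonneg fun i => by positivity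
  refine ⟨C11 + K * C12 + C21 + C22 + 2 * K * S + 2 * S, by positivity, ?_⟩
  intro ε p q u h0 hε hode hu0 hu1
  have h1 : ε ≤ 1 := by linarith
  have hσ1 : |σ' ε| ≤ 1 := by
    have := one_le_sqrt ε h0
    rw [hσ']
    simp only [abs_inv]
    exact inv_le_one_of_one_le₀ (this.trans (le_abs_self _))
  have hκ1 : |κ' ε| ≤ 1 := by
    have := one_le_κ ε h0
    simp only [hκ', abs_inv]
    exact inv_le_one_of_one_le₀ (this.trans (le_abs_self _))
  set m := |p| + |q| with hm
  have hp : |p| ≤ m := by linarith [abs_nonneg q]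
  have hq : |q| ≤ m := by linarith [abs_nonneg p]
  have hm0 : 0 ≤ m := by positivity
  obtain ⟨a, ha0, ha1, ha⟩ := edgeShift_eq h0
  have hx1 : ε ^ 3 ≤ 1 := pow_le_one₀ h0 h1
  have hxa : ε ^ 3 * a ≤ 1 := mul_le_one₀ hx1 ha0 ha1
  have hxa0 : 0 ≤ ε ^ 3 * a := by positivity
  have hδ0 : 0 ≤ edgeShift ε := by rw [ha]; exact mul_nonneg h0 (by linarith)
  have hδε : edgeShift ε ≤ ε := by rw [ha]; exact mul_le_of_le_one_right h0 (by linarith)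
  have hbu0 : |u 0| ≤ m := by
    rw [hu0, abs_mul]
    refine (mul_le_of_le_one_left (abs_nonneg _) hσ1).trans ((abs_sub _ _).trans ?_)
    rw [abs_mul, abs_of_nonneg h0]
    linarith [mul_le_of_le_one_left (abs_nonneg q) h1]
  have hbu1 : |u 1| ≤ m := by
    rw [hu1, abs_mul]
    refine (mul_le_of_le_one_left (abs_nonneg _) hσ1).trans ((abs_add_le _ _).trans ?_)
    rw [abs_mul, abs_of_nonneg (pow_nonneg h0 2)]
    linarith [mul_le_of_le_one_left (abs_nonneg p) (pow_le_one₀ h0 h1 (n := 2))]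
  have hbu := hode.abs_le (M := m) (by rw [abs_le]; constructor <;> linarith) (by simp)
    (by rw [abs_le]; constructor <;> nlinarith) hbu0 hbu1
  have R0 := abs_tsum_sub_four_terms_le (w := u) (M := m) (fun i => (hbu i).trans
    (le_mul_of_one_le_left hm0 (by linarith [i.cast_nonneg (α := ℝ)]))) hδ0 hδε (by linarith)
  have R1 := abs_tsum_sub_four_terms_le (w := fun i => ((i : ℝ) + 1) * u (i + 1)) (M := m)
    (fun i => by
      rw [abs_mul, abs_of_nonneg (by positivity)]
      exact mul_le_mul_of_nonneg_left (hbu _) (by positivity)) hδ0 hδε (by linarith)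
  have e2 : u 2 = -3 / 4 * ε * u 0 := by linarith [hode.zero]
  have e3 : u 3 = (-3 / 2 * ε * u 1 + u 0) / 6 := by linarith [hode.one]
  have e4 : u 4 = (-3 / 2 * ε * u 2 + u 1 + ε ^ 2 / 4 * u 0) / 12 := by
    have := hode.add_two 0
    norm_num at this
    linarith
  change u 0 = σ' ε * _ at hu0
  change u 1 = σ' ε * _ at hu1
  have hε4 : 0 ≤ ε ^ 4 := by positivity
  have hSm : 0 ≤ S * m * ε ^ 4 := by positivity
  constructor
  · have T : κ ε * (u 0 + u 1 * edgeShift ε + u 2 * edgeShift ε ^ 2 + u 3 * edgeShift ε ^ 3) - p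
        = (κ ε * σ' ε * b11 ε - 1) * p + κ ε * (σ' ε * (b12 ε * q)) := by
      rw [e3, e2, hu0, hu1]
      simp only [b11, b12]
      ring
    change |κ ε * _ - p| ≤ _
    rw [show κ ε * ∑' i, u i * edgeShift ε ^ i - p = (κ ε * (u 0 + u 1 * edgeShift ε
      + u 2 * edgeShift ε ^ 2 + u 3 * edgeShift ε ^ 3) - p) + κ ε * (∑' i, u i * edgeShift ε ^ i -
      (u 0 + u 1 * edgeShift ε + u 2 * edgeShift ε ^ 2 + u 3 * edgeShift ε ^ 3)) by ring, T]
    refine (abs_add_three _ _ _).trans ?_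
    rw [abs_mul, abs_mul (κ ε), abs_mul (κ ε), abs_mul (σ' ε), abs_mul (b12 ε)]
    have t1 := mul_le_mul (M11 ε h0 h1) hp (abs_nonneg _) (by positivity)
    have t2 := mul_le_mul (hκK ε h0 h1) (mul_le_mul hσ1 (mul_le_mul (M12 ε h0 h1) hq
      (abs_nonneg _) (by positivity)) (by positivity) zero_le_one) (by positivity) hK
    have t3 := mul_le_mul (hκK ε h0 h1) R0 (abs_nonneg _) hK
    have n1 : 0 ≤ C21 * ε ^ 4 * m := by positivity
    have n2 : 0 ≤ C22 * ε ^ 4 * m := by positivity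
    have n3 : 0 ≤ K * (S * m * ε ^ 4) := by positivity
    linarith
  · have T : κ' ε * (u 1 + 2 * u 2 * edgeShift ε + 3 * u 3 * edgeShift ε ^ 2
          + 4 * u 4 * edgeShift ε ^ 3) - q
        = κ' ε * (σ' ε * (b21 ε * p)) + (κ' ε * σ' ε * b22 ε - 1) * q := by
      rw [e4, e3, e2, hu0, hu1]
      simp only [b21, b22]
      ring
    change |κ' ε * _ - q| ≤ _
    norm_num only [zero_add, Nat.cast_zero, Nat.cast_one, Nat.cast_ofNat] at R1
    simp only [one_mul] at R1
    rw [show κ' ε * ∑' i : ℕ, ((i : ℝ) + 1) * u (i + 1) * edgeShift ε ^ i - q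
      = (κ' ε * (u 1 + 2 * u 2 * edgeShift ε
      + 3 * u 3 * edgeShift ε ^ 2 + 4 * u 4 * edgeShift ε ^ 3) - q)
      + κ' ε * (∑' i : ℕ, ((i : ℝ) + 1) * u (i + 1) * edgeShift ε ^ i -
      (u 1 + 2 * u 2 * edgeShift ε + 3 * u 3 * edgeShift ε ^ 2 + 4 * u 4 * edgeShift ε ^ 3))
      by ring, T]
    refine (abs_add_three _ _ _).trans ?_
    rw [abs_mul, abs_mul (σ' ε), abs_mul (b21 ε), abs_mul _ q, abs_mul (κ' ε)]
    have t1 := mul_le_mul (M22 ε h0 h1) hq (abs_nonneg _) (by positivity)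
    have t2 := mul_le_mul hκ1 (mul_le_mul hσ1 (mul_le_mul (M21 ε h0 h1) hp
      (abs_nonneg _) (by positivity)) (by positivity) zero_le_one) (by positivity) zero_le_one
    have t3 := mul_le_mul hκ1 R1 (abs_nonneg _) zero_le_one
    have n1 : 0 ≤ C11 * ε ^ 4 * m := by positivity
    have n2 : 0 ≤ K * C12 * ε ^ 4 * m := by positivity
    have n3 : 0 ≤ K * (S * m * ε ^ 4) := by positivity
    linarith

/-! ### The edge limit of the Hermite functions -/

theorem softScale_pos {N : ℕ} (hN : 1 ≤ N) : 0 < softScale N := by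
  have : (0 : ℝ) < N := by exact_mod_cast hN
  rw [softScale]
  positivity

theorem rpow_sixth_pow (N : ℕ) : ((N : ℝ) ^ ((1 : ℝ) / 6)) ^ 6 = N := by
  rw [← Real.rpow_natCast, ← Real.rpow_mul N.cast_nonneg]
  norm_num

theorem sqrt_two_mul_eq (N : ℕ) :
    Real.sqrt (2 * (N : ℝ)) = Real.sqrt 2 * ((N : ℝ) ^ ((1 : ℝ) / 6)) ^ 3 := by
  rw [Real.sqrt_mul zero_le_two]
  congr 1
  rw [Real.sqrt_eq_iff_eq_sq N.cast_nonneg (by positivity), ← pow_mul, rpow_sixth_pow]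

theorem two_mul_sqrt_mul_softScale {N : ℕ} (hN : 1 ≤ N) :
    2 * Real.sqrt (2 * (N : ℝ)) * softScale N ^ 3 = 1 := by
  have : (0 : ℝ) < N := by exact_mod_cast hN
  have hy : 0 < (N : ℝ) ^ ((1 : ℝ) / 6) := by positivity
  have h2 := Real.sq_sqrt (show (0 : ℝ) ≤ 2 by norm_num)
  rw [sqrt_two_mul_eq, softScale]
  generalize (N : ℝ) ^ ((1 : ℝ) / 6) = y at hy
  field_simp
  rw [h2]

/-- Value and derivative at the edge `√(2n)` of the Hermite function `φ_n`, in the edge scaling. -/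
noncomputable def edgeValue (n : ℕ) : ℝ × ℝ :=
  (scaledHermite (Real.sqrt (2 * (n : ℝ))) (softScale n) n 0,
    scaledHermite (Real.sqrt (2 * (n : ℝ))) (softScale n) n 1)

theorem edgeValue_ne_zero {n : ℕ} (hn : 1 ≤ n) : edgeValue n ≠ 0 := by
  intro h
  have hs := softScale_pos hn
  have h2 : Real.sqrt (2 * softScale n) ≠ 0 := Real.sqrt_ne_zero'.2 (by positivity)
  have h3 := congrArg Prod.fst h
  have h4 := congrArg Prod.snd h
  simp only [edgeValue, scaledHermite_zero, scaledHermite_one, Prod.fst_zero, Prod.snd_zero,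
    div_eq_zero_iff, mul_eq_zero, h2, hs.ne', or_false, false_or] at h3 h4
  exact (hermiteFun_ne_zero_or n _).elim (fun h => h h3) (fun h => h h4)

/-- The recursion of `exists_edge_step_bound` for the Hermite functions. With `y = n^{1/6}` one has
`s_n = 1 / (√2 y)`, `√(2n) = √2 y³` and `ε = y⁻²`; the factors `σ = √(1 + ε³)` and
`κ = (1 + ε³)^{1/12}` come from `√(2n + 2) = √(2n) σ` and `s_{n+1} = s_n / κ²`. -/
theorem exists_edgeValue_step : ∃ C, 0 ≤ C ∧ ∀ n ≥ 8,
    ‖edgeValue (n + 1) - edgeValue n‖ ≤ C * (n : ℝ) ^ (-(4 / 3) : ℝ) * ‖edgeValue n‖ := by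
  obtain ⟨C, hC, hstep⟩ := exists_edge_step_bound
  refine ⟨2 * C, by positivity, fun n hn => ?_⟩
  have hn1 : 1 ≤ n := by omega
  have hn0 : (0 : ℝ) < n := by exact_mod_cast hn1
  have hs := softScale_pos hn1
  have hb := sqrt_two_mul_eq n
  have hy6 := rpow_sixth_pow n
  have hy : 0 < (n : ℝ) ^ ((1 : ℝ) / 6) := by positivity
  have hs_def : softScale n = 1 / (Real.sqrt 2 * (n : ℝ) ^ ((1 : ℝ) / 6)) := rfl
  have hs_def' : softScale (n + 1)
    = 1 / (Real.sqrt 2 * ((n + 1 : ℕ) : ℝ) ^ ((1 : ℝ) / 6)) := rfl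
  have hrt := Real.sq_sqrt (show (0 : ℝ) ≤ 2 by norm_num)
  have hrt0 : Real.sqrt 2 ≠ 0 := by positivity
  set y := (n : ℝ) ^ ((1 : ℝ) / 6) with hy_def
  set ε := (y ^ 2)⁻¹ with hε_def
  have hε0 : 0 < ε := by positivity
  have hε3 : ε ^ 3 = (y ^ 6)⁻¹ := by rw [hε_def, inv_pow, ← pow_mul]
  have hε3n : ε ^ 3 * n = 1 := by rw [hε3, hy6, inv_mul_cancel₀ hn0.ne']
  have hε4 : ε ^ 4 = (n : ℝ) ^ (-(4 / 3) : ℝ) := by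
    rw [hε_def, inv_pow, ← pow_mul, hy_def, ← Real.rpow_natCast, ← Real.rpow_mul hn0.le,
      ← Real.rpow_neg hn0.le]
    norm_num
  have hεhalf : ε ≤ 1 / 2 := by
    by_contra! h
    have h3 : (1 / 2 : ℝ) ^ 3 < ε ^ 3 := pow_lt_pow_left₀ h (by norm_num) (by norm_num)
    have h8 : (8 : ℝ) ≤ n := by exact_mod_cast hn
    have := mul_lt_mul_of_pos_right h3 hn0
    rw [hε3n] at this
    linarith
  have hx : 0 ≤ ε ^ 3 := by positivity
  have hn1' : ((n : ℝ) + 1) = y ^ 6 * (1 + ε ^ 3) := by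
    rw [hε3, mul_add, mul_inv_cancel₀ (by positivity), hy6, mul_one]
  set σ := Real.sqrt (1 + ε ^ 3) with hσ_def
  have hσ0 : 0 < σ := Real.sqrt_pos.2 (by linarith)
  have hσ2 : σ ^ 2 = 1 + ε ^ 3 := Real.sq_sqrt (by linarith)
  set κ := (1 + ε ^ 3) ^ ((1 : ℝ) / 12) with hκ_def
  have hκ0 : 0 < κ := by positivity
  have hr : Real.sqrt (2 * ((n : ℝ) + 1)) = Real.sqrt 2 * y ^ 3 * σ := by
    rw [Real.sqrt_mul zero_le_two, hn1', Real.sqrt_mul (by positivity), ← hσ_def,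
      show y ^ 6 = (y ^ 3) ^ 2 by ring, Real.sqrt_sq (by positivity), mul_assoc]
  have hs' : softScale (n + 1) = softScale n / κ ^ 2 := by
    have : ((n + 1 : ℕ) : ℝ) ^ ((1 : ℝ) / 6) = y * κ ^ 2 := by
      have hκ2 : κ ^ 2 = (1 + ε ^ 3) ^ ((1 : ℝ) / 6) := by
        rw [hκ_def, ← Real.rpow_natCast _ 2, ← Real.rpow_mul (by positivity)]
        norm_num
      push_cast
      rw [hn1', Real.mul_rpow (by positivity) (by positivity), hy6, hκ2]
    rw [hs_def', this, hs_def]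
    field_simp
  have hb' : Real.sqrt (2 * ((n + 1 : ℕ) : ℝ))
      = Real.sqrt (2 * (n : ℝ)) + softScale n * edgeShift ε := by
    have h1 : y ^ 6 * (σ ^ 2 - 1) = 1 := by
      rw [hσ2, hε3, add_sub_cancel_left, mul_inv_cancel₀ (by positivity)]
    push_cast
    rw [hr, hb, hs_def, edgeShift, ← hσ_def, hε_def]
    field_simp
    rw [hrt]
    linear_combination 2 * h1
  set b := Real.sqrt (2 * (n : ℝ)) with hb_def
  set s := softScale n
  have hsq : s ^ 2 = ε / 2 := by
    rw [hs_def, hε_def]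
    field_simp
    rw [hrt]
  have hb2 : b ^ 2 = 2 * n := Real.sq_sqrt (by positivity)
  set w := Real.sqrt (2 * s) with hw
  have hw0 : w ≠ 0 := Real.sqrt_ne_zero'.2 (by positivity)
  have hw' : Real.sqrt (2 * softScale (n + 1)) = w / κ := by
    rw [hs', ← mul_div_assoc, Real.sqrt_div (by positivity), Real.sqrt_sq hκ0.le]
  set p := scaledHermite b s n 0 with hp
  set q := scaledHermite b s n 1 with hq
  set u := scaledHermite b s (n + 1) with hu
  have hode : QuadODE (-3 / 2 * ε) 1 (ε ^ 2 / 4) u := by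
    have h := quadODE_scaledHermite b s (n + 1)
    have e1 : s ^ 2 * (b ^ 2 - (2 * ((n + 1 : ℕ) : ℝ) + 1)) = -3 / 2 * ε := by
      rw [hb2, hsq]; push_cast; ring
    have e3 : s ^ 4 = ε ^ 2 / 4 := by
      rw [show s ^ 4 = (s ^ 2) ^ 2 by ring, hsq]; ring
    rwa [e1, two_mul_sqrt_mul_softScale hn1, e3] at h
  have hu0 : u 0 = σ⁻¹ * (p - ε * q) := by
    have h := hermiteFun_raise n b
    rw [hr] at h
    rw [hu, hp, hq, scaledHermite_zero, scaledHermite_zero, scaledHermite_one,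
      eq_div_of_mul_eq (by positivity) ((mul_comm _ _).trans h), hb, ← hw, hs_def, hε_def]
    field_simp
  have hu1 : u 1 = σ⁻¹ * (q + ε ^ 2 * p) := by
    have h : u 1 = s * Real.sqrt 2 * y ^ 3 * (σ * p - u 0) := by
      rw [hu, hp, scaledHermite_zero, scaledHermite_zero, scaledHermite_one, hermiteFunDeriv_succ,
        hr, hb]
      ring
    have h1 : σ ^ 2 = 1 + (y ^ 6)⁻¹ := by rw [hσ2, hε3]
    rw [h, hu0, hs_def, hε_def]
    field_simp
    rw [h1]
    field_simp
    ring
  obtain ⟨h1, h2⟩ := hstep ε p q u hε0.le hεhalf hode hu0 hu1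
  have hp' : (edgeValue (n + 1)).1 = κ * ∑' i, u i * edgeShift ε ^ i := by
    rw [(hasSum_scaledHermite b s (n + 1) (edgeShift ε)).tsum_eq, edgeValue, scaledHermite_zero,
      hw', hb', ← hw]
    field_simp
  have hq' : (edgeValue (n + 1)).2
      = κ⁻¹ * ∑' i : ℕ, ((i : ℝ) + 1) * u (i + 1) * edgeShift ε ^ i := by
    rw [(hasSum_scaledHermite_deriv b s (n + 1) (edgeShift ε)).tsum_eq, edgeValue,
      scaledHermite_one, hw', hb', hs', ← hw]
    field_simp
  have hbd : |p| + |q| ≤ 2 * ‖edgeValue n‖ := by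
    have e1 := norm_fst_le (edgeValue n)
    have e2 := norm_snd_le (edgeValue n)
    rw [Real.norm_eq_abs] at e1 e2
    change |p| ≤ _ at e1
    change |q| ≤ _ at e2
    linarith
  have hfin := mul_le_mul_of_nonneg_left hbd (show 0 ≤ C * ε ^ 4 by positivity)
  rw [← hp'] at h1
  rw [← hq'] at h2
  rw [← hε4, Prod.norm_def]
  refine max_le ?_ ?_
  · rw [Real.norm_eq_abs]
    change |(edgeValue (n + 1)).1 - p| ≤ _
    linarith
  · rw [Real.norm_eq_abs]
    change |(edgeValue (n + 1)).2 - q| ≤ _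
    linarith

/-- The values of the Hermite functions at the edge have a nonzero limit in the edge scaling. -/
theorem exists_tendsto_edgeValue : ∃ L : ℝ × ℝ, L ≠ 0 ∧ Tendsto edgeValue atTop (𝓝 L) := by
  obtain ⟨C, hC, h⟩ := exists_edgeValue_step
  refine exists_tendsto_ne_zero_of_relative_increments
    (e := fun n => C * (n : ℝ) ^ (-(4 / 3) : ℝ)) (fun n => by positivity)
    ((Real.summable_nat_rpow.2 (by norm_num)).mul_left C) 8
    (fun n hn => edgeValue_ne_zero (by omega)) h

/-- The coefficients of the power series solution of `u'' = (α + β x + γ x²) u` with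
`u(0) = u₀`, `u'(0) = u₁`. -/
noncomputable def quadSol (α β γ u₀ u₁ : ℝ) : ℕ → ℝ
  | 0 => u₀
  | 1 => u₁
  | 2 => α * u₀ / 2
  | 3 => (α * u₁ + β * u₀) / 6
  | i + 4 => (α * quadSol α β γ u₀ u₁ (i + 2) + β * quadSol α β γ u₀ u₁ (i + 1)
      + γ * quadSol α β γ u₀ u₁ i) / (((i : ℝ) + 4) * ((i : ℝ) + 3))

theorem quadODE_quadSol (α β γ u₀ u₁ : ℝ) : QuadODE α β γ (quadSol α β γ u₀ u₁) where
  zero := by simp only [quadSol]; ring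
  one := by simp only [quadSol]; ring
  add_two i := by
    have : ((i : ℝ) + 4) * ((i : ℝ) + 3) ≠ 0 := by positivity
    conv_lhs => rw [quadSol]
    rw [mul_div_cancel₀ _ this]

theorem QuadODE.eq_zero {α β γ : ℝ} {u : ℕ → ℝ} (h : QuadODE α β γ u) (h0 : u 0 = 0)
    (h1 : u 1 = 0) (i : ℕ) : u i = 0 := by
  induction i using Nat.strong_induction_on with
  | _ i ih =>
    rcases i with _ | _ | _ | _ | i
    · exact h0
    · exact h1
    · have := h.zero
      rw [h0] at this
      change u 2 = 0
      linarith
    · have := h.one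
      rw [h0, h1] at this
      change u 3 = 0
      linarith
    · have hne : ((i : ℝ) + 4) * ((i : ℝ) + 3) ≠ 0 := by positivity
      have := h.add_two i
      rw [ih (i + 2) (by omega), ih (i + 1) (by omega), ih i (by omega)] at this
      simpa [hne] using this

theorem tendsto_softScale : Tendsto softScale atTop (𝓝 0) := by
  have h1 : Tendsto (fun N : ℕ => (N : ℝ) ^ ((1 : ℝ) / 6)) atTop atTop :=
    (tendsto_rpow_atTop (by norm_num)).comp tendsto_natCast_atTop_atTop
  have h2 := (h1.const_mul_atTop (show 0 < Real.sqrt 2 by positivity)).inv_tendsto_atTop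
  refine h2.congr fun N => ?_
  simp only [softScale, one_div, Pi.inv_apply]

theorem softPoint_eq (c : ℝ) (N : ℕ) :
    softPoint c N = Real.sqrt (2 * (N : ℝ)) + softScale N * c := by
  rw [softPoint, mul_comm c]

/-- Passing from `φ_n` to `φ_{n+1}` at the same point near the edge does not change the limit of
the scaled initial values. -/
theorem tendsto_scaledHermite_ladder (c : ℝ) (L : ℕ) {u₀ u₁ : ℝ}
    (h0 : Tendsto (fun N => scaledHermite (softPoint c N) (softScale N) N 0) atTop (𝓝 u₀))
    (h1 : Tendsto (fun N => scaledHermite (softPoint c N) (softScale N) N 1) atTop (𝓝 u₁)) :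
    Tendsto (fun N => scaledHermite (softPoint c N) (softScale N) (N + L) 0) atTop (𝓝 u₀) ∧
      Tendsto (fun N => scaledHermite (softPoint c N) (softScale N) (N + L) 1) atTop (𝓝 u₁) := by
  induction L with
  | zero => exact ⟨h0, h1⟩
  | succ L ih =>
    obtain ⟨ih0, ih1⟩ := ih
    let r : ℕ → ℝ := fun N => Real.sqrt (2 * (((N + L : ℕ) : ℝ) + 1))
    have hr : ∀ N, 0 < r N := fun N => Real.sqrt_pos.2 (by positivity)
    have hs := tendsto_softScale
    have hbr : Tendsto (fun N : ℕ => Real.sqrt (2 * (N : ℝ)) / r N) atTop (𝓝 1) := by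
      have h := (tendsto_natCast_div_add_atTop (𝕜 := ℝ) ((L : ℝ) + 1)).sqrt
      rw [Real.sqrt_one] at h
      refine h.congr fun N => ?_
      rw [← Real.sqrt_div (by positivity)]
      congr 1
      push_cast
      rw [mul_div_mul_left _ _ two_ne_zero, add_assoc]
    have hrinv : Tendsto (fun N : ℕ => (r N)⁻¹) atTop (𝓝 0) := by
      refine Tendsto.inv_tendsto_atTop ?_
      refine Real.tendsto_sqrt_atTop.comp ?_
      refine Tendsto.const_mul_atTop two_pos ?_
      refine tendsto_atTop_add_const_right _ _ ?_
      exact tendsto_natCast_atTop_atTop.comp (tendsto_add_atTop_nat L)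
    have har : Tendsto (fun N : ℕ => softPoint c N / r N) atTop (𝓝 1) := by
      have h := hbr.add ((hs.mul_const c).mul hrinv)
      simp only [mul_zero, add_zero, zero_mul] at h
      refine h.congr fun N => ?_
      rw [softPoint_eq]
      ring
    have hsr : Tendsto (fun N : ℕ => 1 / (softScale N * r N)) atTop (𝓝 0) := by
      have h := hbr.mul ((hs.pow 2).const_mul 2)
      rw [zero_pow two_ne_zero, mul_zero, mul_zero] at h
      refine h.congr' ?_
      filter_upwards [eventually_ge_atTop 1] with N hN
      have e := two_mul_sqrt_mul_softScale hN
      have := softScale_pos hN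
      have := hr N
      field_simp
      linarith
    have hd : Tendsto (fun N : ℕ => softScale N * (r N ^ 2 - softPoint c N ^ 2) / r N) atTop
        (𝓝 0) := by
      have h := (((hs.mul hrinv).const_mul (2 * L + 2 : ℝ)).sub (hsr.const_mul c)).sub
        (((hs.pow 3).mul hrinv).const_mul (c ^ 2))
      norm_num at h
      refine h.congr' ?_
      filter_upwards [eventually_ge_atTop 1] with N hN
      have e := two_mul_sqrt_mul_softScale hN
      have h1 := softScale_pos hN
      have h2 := hr N
      have e2 : Real.sqrt (2 * (N : ℝ)) ^ 2 = 2 * N := Real.sq_sqrt (by positivity)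
      have e3 : r N ^ 2 = 2 * (((N + L : ℕ) : ℝ) + 1) := Real.sq_sqrt (by positivity)
      rw [softPoint_eq]
      field_simp
      push_cast at e3
      linear_combination (-softScale N ^ 2) * e3 + softScale N ^ 2 * e2 + c * e
    have key0 : ∀ᶠ N in atTop, softPoint c N / r N
        * scaledHermite (softPoint c N) (softScale N) (N + L) 0
        - 1 / (softScale N * r N) * scaledHermite (softPoint c N) (softScale N) (N + L) 1
        = scaledHermite (softPoint c N) (softScale N) (N + (L + 1)) 0 := by
      filter_upwards [eventually_ge_atTop 1] with N hN
      have h1 := softScale_pos hN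
      have h2 := hr N
      have h := hermiteFun_raise (N + L) (softPoint c N)
      change r N * _ = _ at h
      have h3 : 0 < Real.sqrt (2 * softScale N) := Real.sqrt_pos.2 (by positivity)
      rw [← add_assoc, scaledHermite_zero, scaledHermite_zero, scaledHermite_one,
        eq_div_of_mul_eq h2.ne' ((mul_comm _ _).trans h)]
      field_simp
    have key1 : ∀ᶠ N in atTop, softScale N * (r N ^ 2 - softPoint c N ^ 2) / r N
        * scaledHermite (softPoint c N) (softScale N) (N + L) 0
        + softPoint c N / r N * scaledHermite (softPoint c N) (softScale N) (N + L) 1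
        = scaledHermite (softPoint c N) (softScale N) (N + (L + 1)) 1 := by
      filter_upwards [eventually_ge_atTop 1] with N hN
      have h1 := softScale_pos hN
      have h2 := hr N
      have h := hermiteFun_raise (N + L) (softPoint c N)
      change r N * _ = _ at h
      have h' := hermiteFunDeriv_succ (N + L) (softPoint c N)
      change _ = r N * _ - _ at h'
      have h3 : 0 < Real.sqrt (2 * softScale N) := Real.sqrt_pos.2 (by positivity)
      rw [← add_assoc, scaledHermite_zero, scaledHermite_one, scaledHermite_one, h',
        eq_div_of_mul_eq h2.ne' ((mul_comm _ _).trans h)]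
      field_simp
      ring
    constructor
    · have h := (har.mul ih0).sub (hsr.mul ih1)
      rw [one_mul, zero_mul, sub_zero] at h
      exact h.congr' key0
    · have h := (hd.mul ih0).add (har.mul ih1)
      rw [one_mul, zero_mul, zero_add] at h
      exact h.congr' key1

/-- The edge limit of the Hermite functions. In the edge scaling around `√(2N) + c s_N` the Taylor
coefficients of `φ_{N + L}` converge, for every `L` to the same nonzero solution of
`u'' = (x + c) u`. -/
theorem exists_edge_limit (c : ℝ) : ∃ u : ℕ → ℝ, (u 0 ≠ 0 ∨ u 1 ≠ 0) ∧ QuadODE c 1 0 u ∧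
    ∀ L : ℕ, DomConv atTop
      (fun N => scaledHermite (softPoint c N) (softScale N) (N + L)) u := by
  obtain ⟨⟨v₀, v₁⟩, hv, hlim⟩ := exists_tendsto_edgeValue
  have hs := tendsto_softScale
  set v := quadSol 0 1 0 v₀ v₁ with hvdef
  have hD : DomConv atTop
      (fun N : ℕ => scaledHermite (Real.sqrt (2 * (N : ℝ))) (softScale N) N) v := by
    refine DomConv.of_quadODE (α := fun N => -softScale N ^ 2) (β := fun _ => 1)
      (γ := fun N => softScale N ^ 4) ?_ tendsto_const_nhds ?_ ?_ (quadODE_quadSol _ _ _ _ _)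
      ((continuous_fst.tendsto _).comp hlim) ((continuous_snd.tendsto _).comp hlim)
    · simpa using (hs.pow 2).neg
    · simpa using hs.pow 4
    · filter_upwards [eventually_ge_atTop 1] with N hN
      have h := quadODE_scaledHermite (Real.sqrt (2 * (N : ℝ))) (softScale N) N
      rw [two_mul_sqrt_mul_softScale hN, Real.sq_sqrt (by positivity)] at h
      convert! h using 1
      ring
  set u₀ := ∑' i, v i * c ^ i with hu₀
  set u₁ := ∑' i : ℕ, ((i : ℝ) + 1) * v (i + 1) * c ^ i with hu₁
  have h0 : Tendsto (fun N => scaledHermite (softPoint c N) (softScale N) N 0) atTop (𝓝 u₀) := by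
    refine (hD.tendsto_tsum (tendsto_const_nhds (x := c))).congr fun N => ?_
    rw [(hasSum_scaledHermite _ _ N c).tsum_eq, scaledHermite_zero, softPoint_eq]
  have h1 : Tendsto (fun N => scaledHermite (softPoint c N) (softScale N) N 1) atTop (𝓝 u₁) := by
    refine (hD.deriv.tendsto_tsum (tendsto_const_nhds (x := c))).congr fun N => ?_
    rw [(hasSum_scaledHermite_deriv _ _ N c).tsum_eq, scaledHermite_one, softPoint_eq]
  set u := quadSol c 1 0 u₀ u₁ with hudef
  have hode : QuadODE c 1 0 u := quadODE_quadSol _ _ _ _ _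
  have hU : ∀ L : ℕ, DomConv atTop
      (fun N => scaledHermite (softPoint c N) (softScale N) (N + L)) u := by
    intro L
    obtain ⟨hL0, hL1⟩ := tendsto_scaledHermite_ladder c L h0 h1
    refine DomConv.of_quadODE
      (α := fun N => c + softScale N ^ 4 * c ^ 2 - softScale N ^ 2 * (2 * L + 1))
      (β := fun N => 1 + 2 * c * softScale N ^ 4)
      (γ := fun N => softScale N ^ 4) ?_ ?_ ?_ ?_ hode hL0 hL1
    · simpa using (((hs.pow 4).mul_const (c ^ 2)).const_add c).sub
        ((hs.pow 2).mul_const (2 * (L : ℝ) + 1))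
    · simpa using ((hs.pow 4).const_mul (2 * c)).const_add 1
    · simpa using hs.pow 4
    · filter_upwards [eventually_ge_atTop 1] with N hN
      have h := quadODE_scaledHermite (softPoint c N) (softScale N) (N + L)
      have e := two_mul_sqrt_mul_softScale hN
      have e2 : Real.sqrt (2 * (N : ℝ)) ^ 2 = 2 * N := Real.sq_sqrt (by positivity)
      convert! h using 1
      · rw [softPoint_eq]
        push_cast
        linear_combination (-c) * e - softScale N ^ 2 * e2
      · rw [softPoint_eq]
        linear_combination -e
  refine ⟨u, ?_, hode, hU⟩
  -- if both initial values vanished at `c`, moving the base point back to `0` would give `v = 0`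
  by_contra! hzero
  have hu : ∀ i, u i = 0 := hode.eq_zero hzero.1 hzero.2
  have hback : ∀ N : ℕ, softPoint c N + softScale N * (-c) = Real.sqrt (2 * (N : ℝ)) := by
    intro N
    rw [softPoint_eq]
    ring
  have z0 : v₀ = 0 := by
    have h := (hU 0).tendsto_tsum (tendsto_const_nhds (x := -c))
    simp only [hu, zero_mul, tsum_zero] at h
    refine tendsto_nhds_unique (hD.tendsto 0) (h.congr fun N => ?_)
    rw [(hasSum_scaledHermite _ _ (N + 0) (-c)).tsum_eq, hback, scaledHermite_zero]
    rfl
  have z1 : v₁ = 0 := by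
    have h := (hU 0).deriv.tendsto_tsum (tendsto_const_nhds (x := -c))
    simp only [hu, zero_mul, mul_zero, tsum_zero] at h
    refine tendsto_nhds_unique (hD.tendsto 1) (h.congr fun N => ?_)
    rw [(hasSum_scaledHermite_deriv _ _ (N + 0) (-c)).tsum_eq, hback, scaledHermite_one]
    rfl
  exact hv (by rw [z0, z1]; rfl)

/-! ### Nondegeneracy of the limit -/

/-- The logarithmic derivative `r` of a solution of `v'' = (x + c) v` is not rational: the Riccati
equation `r' + r² = x + c` would equate an even degree with an odd one. -/
theorem polynomial_relation_trivial {v : PowerSeries ℝ} {c : ℝ} (hv : v ≠ 0)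
    (hode : PowerSeries.derivative ℝ (PowerSeries.derivative ℝ v)
      = (PowerSeries.C c + PowerSeries.X) * v)
    {P Q : ℝ[X]} (h : (P : PowerSeries ℝ) * v = Q * PowerSeries.derivative ℝ v) :
    P = 0 ∧ Q = 0 := by
  have hP_of : Q = 0 → P = 0 := by
    rintro rfl
    rw [Polynomial.coe_zero, zero_mul] at h
    exact Polynomial.coe_eq_zero_iff.1 ((mul_eq_zero.1 h).resolve_right hv)
  suffices hQ : Q = 0 from ⟨hP_of hQ, hQ⟩
  by_contra hQ
  have hric : derivative P * Q + P ^ 2 - derivative Q * P = Q ^ 2 * (X + C c) := by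
    have h' := congrArg (PowerSeries.derivative ℝ) h
    rw [Derivation.leibniz, Derivation.leibniz, PowerSeries.derivative_coe,
      PowerSeries.derivative_coe, hode] at h'
    simp only [smul_eq_mul] at h'
    apply Polynomial.coe_injective
    apply mul_right_cancel₀ hv
    simp only [Polynomial.coe_sub, Polynomial.coe_add, Polynomial.coe_mul, Polynomial.coe_pow,
      Polynomial.coe_X, Polynomial.coe_C]
    linear_combination (Q : PowerSeries ℝ) * h'
      + ((P : PowerSeries ℝ) - (derivative Q : ℝ[X])) * h
  have hR : (Q ^ 2 * (X + C c)).natDegree = 2 * Q.natDegree + 1 := by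
    rw [natDegree_mul (pow_ne_zero _ hQ) (X_add_C_ne_zero c), natDegree_pow, natDegree_X_add_C]
  have h1 : (derivative P * Q).natDegree ≤ P.natDegree + Q.natDegree - 1 ∨ P.natDegree = 0 := by
    by_cases hp : P.natDegree = 0
    · exact Or.inr hp
    · left
      have := natDegree_mul_le (p := derivative P) (q := Q)
      have := natDegree_derivative_le P
      omega
  have h1' : (derivative P * Q).natDegree ≤ P.natDegree + Q.natDegree :=
    natDegree_mul_le.trans (by have := natDegree_derivative_le P; omega)
  have h2' : (derivative Q * P).natDegree ≤ P.natDegree + Q.natDegree :=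
    natDegree_mul_le.trans (by have := natDegree_derivative_le Q; omega)
  have hP2 : (P ^ 2).natDegree = 2 * P.natDegree := natDegree_pow P 2
  rcases le_or_gt P.natDegree Q.natDegree with hle | hgt
  · have hL : (derivative P * Q + P ^ 2 - derivative Q * P).natDegree ≤ 2 * Q.natDegree := by
      refine (natDegree_sub_le _ _).trans (max_le ((natDegree_add_le _ _).trans (max_le ?_ ?_)) ?_)
        <;> omega
    rw [hric, hR] at hL
    omega
  · have e : derivative P * Q + P ^ 2 - derivative Q * P
        = P ^ 2 + (derivative P * Q - derivative Q * P) := by ring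
    have hlt : (derivative P * Q - derivative Q * P).natDegree < (P ^ 2).natDegree := by
      refine (natDegree_sub_le _ _).trans_lt ?_
      rw [hP2]
      exact max_lt (by omega) (by omega)
    have hL := natDegree_add_eq_left_of_natDegree_lt hlt
    rw [← e, hric, hR, hP2] at hL
    omega

theorem derivative_derivative_mk {c : ℝ} {u : ℕ → ℝ} (hode : QuadODE c 1 0 u) :
    PowerSeries.derivative ℝ (PowerSeries.derivative ℝ (PowerSeries.mk u))
      = (PowerSeries.C c + PowerSeries.X) * PowerSeries.mk u := by
  ext i
  rw [PowerSeries.coeff_derivative, PowerSeries.coeff_derivative, add_mul, map_add,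
    PowerSeries.coeff_C_mul, PowerSeries.coeff_mk, PowerSeries.coeff_mk]
  rcases i with _ | _ | i
  · have := hode.zero
    rw [PowerSeries.coeff_zero_X_mul]
    push_cast
    linarith
  · have := hode.one
    rw [PowerSeries.coeff_succ_X_mul, PowerSeries.coeff_mk]
    push_cast
    linarith
  · have := hode.add_two i
    rw [PowerSeries.coeff_succ_X_mul, PowerSeries.coeff_mk]
    push_cast
    linarith

/-- The columns of the coefficient array of `(u(x) u'(y) - u'(x) u(y)) / (x - y)` are, up to a
power of `x`, combinations of `u` and `u'` with polynomial coefficients. -/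
theorem exists_polynomial_column {u : ℕ → ℝ}
    (hsymm : ∀ i j, cdCoeff 0 u i j = cdCoeff 0 u j i) (j : ℕ) :
    ∃ P Q : ℝ[X], P.coeff 0 = u 1 ∧ Q.coeff 0 = u 0 ∧
      PowerSeries.X ^ (j + 1) * PowerSeries.mk (fun i => cdCoeff 0 u i j)
        = (P : PowerSeries ℝ) * PowerSeries.mk u
          - (Q : PowerSeries ℝ) * PowerSeries.derivative ℝ (PowerSeries.mk u) := by
  have hw : ∀ i, PowerSeries.coeff i (PowerSeries.derivative ℝ (PowerSeries.mk u))
      = u (i + 1) * (i + 1) := fun i => by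
    rw [PowerSeries.coeff_derivative, PowerSeries.coeff_mk]
  have hzero : ∀ i, cdCoeff 0 u i 0 = u (i + 1) * u 1 - ((i : ℝ) + 2) * u (i + 2) * u 0 :=
    fun i => by rw [cdCoeff, zero_mul, sub_zero]
  have hsucc : ∀ i j : ℕ, cdCoeff 0 u i (j + 1) = cdCoeff 0 u (i + 1) j
      + (u (i + 1) * (((j : ℝ) + 2) * u (j + 2)) - ((i : ℝ) + 2) * u (i + 2) * u (j + 1)) :=
    fun i j => by rw [cdCoeff, zero_mul, sub_zero]
  induction j with
  | zero =>
    refine ⟨C (u 1), C (u 0), by simp, by simp, ?_⟩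
    ext i
    rw [zero_add, pow_one, map_sub, Polynomial.coe_C, Polynomial.coe_C, PowerSeries.coeff_C_mul,
      PowerSeries.coeff_C_mul, hw, PowerSeries.coeff_mk]
    rcases i with _ | i
    · rw [PowerSeries.coeff_zero_X_mul]
      push_cast
      ring
    · rw [PowerSeries.coeff_succ_X_mul, PowerSeries.coeff_mk, hzero]
      push_cast
      ring
  | succ j ih =>
    obtain ⟨P, Q, hP, hQ, h⟩ := ih
    have hstep : PowerSeries.X * PowerSeries.mk (fun i => cdCoeff 0 u i (j + 1))
        = PowerSeries.mk (fun i => cdCoeff 0 u i j)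
          + PowerSeries.C (((j : ℝ) + 2) * u (j + 2)) * PowerSeries.mk u
          - PowerSeries.C (u (j + 1)) * PowerSeries.derivative ℝ (PowerSeries.mk u) := by
      ext i
      rw [map_sub, map_add, PowerSeries.coeff_C_mul, PowerSeries.coeff_C_mul, hw,
        PowerSeries.coeff_mk, PowerSeries.coeff_mk]
      rcases i with _ | i
      · rw [PowerSeries.coeff_zero_X_mul, hsymm, hzero]
        push_cast
        ring
      · rw [PowerSeries.coeff_succ_X_mul, PowerSeries.coeff_mk, hsucc]
        push_cast
        ring
    refine ⟨P + C (((j : ℝ) + 2) * u (j + 2)) * X ^ (j + 1), Q + C (u (j + 1)) * X ^ (j + 1),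
      by simp [hP], by simp [hQ], ?_⟩
    rw [pow_succ, mul_assoc, hstep, mul_sub, mul_add, h]
    simp only [Polynomial.coe_add, Polynomial.coe_mul, Polynomial.coe_C, Polynomial.coe_pow,
      Polynomial.coe_X]
    ring

/-- The columns of the coefficient array of the Airy kernel are linearly independent. -/
theorem cdCoeff_columns_independent {c : ℝ} {u : ℕ → ℝ} (hode : QuadODE c 1 0 u)
    (hu : u 0 ≠ 0 ∨ u 1 ≠ 0) (hsymm : ∀ i j, cdCoeff 0 u i j = cdCoeff 0 u j i) (m : ℕ)
    (d : ℕ → ℝ) :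
    ¬ ∀ i, cdCoeff 0 u i m + ∑ k ∈ Finset.range m, d k * cdCoeff 0 u i k = 0 := by
  intro h
  choose P Q hP hQ hcol using exists_polynomial_column hsymm
  have hv : PowerSeries.mk u ≠ 0 := by
    intro h0
    have hz : ∀ i, u i = 0 := fun i => by
      rw [← PowerSeries.coeff_mk (R := ℝ) i u, h0, map_zero]
    exact hu.elim (fun h => h (hz 0)) (fun h => h (hz 1))
  have hsum : PowerSeries.mk (fun i => cdCoeff 0 u i m)
      + ∑ k ∈ Finset.range m, PowerSeries.C (d k) * PowerSeries.mk (fun i => cdCoeff 0 u i k)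
      = 0 := by
    ext i
    rw [map_add, map_sum, PowerSeries.coeff_mk, map_zero]
    refine Eq.trans (congrArg _ (Finset.sum_congr rfl fun k _ => ?_)) (h i)
    rw [PowerSeries.coeff_C_mul, PowerSeries.coeff_mk]
  set P' : ℝ[X] := P m + ∑ k ∈ Finset.range m, C (d k) * X ^ (m - k) * P k with hP'
  set Q' : ℝ[X] := Q m + ∑ k ∈ Finset.range m, C (d k) * X ^ (m - k) * Q k with hQ'
  have hcoeff : ∀ R : ℕ → ℝ[X],
      (R m + ∑ k ∈ Finset.range m, C (d k) * X ^ (m - k) * R k).coeff 0 = (R m).coeff 0 := by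
    intro R
    have hz : ∀ k ∈ Finset.range m, (C (d k) * X ^ (m - k) * R k).coeff 0 = 0 := by
      intro k hk
      have : m - k ≠ 0 := by have := Finset.mem_range.1 hk; omega
      simp [mul_coeff_zero, this.symm]
    rw [coeff_add, finsetSum_coeff, Finset.sum_eq_zero hz, add_zero]
  have hrel : (P' : PowerSeries ℝ) * PowerSeries.mk u
      = Q' * PowerSeries.derivative ℝ (PowerSeries.mk u) := by
    have h0 := congrArg (fun F => PowerSeries.X ^ (m + 1) * F) hsum
    simp only [mul_zero, mul_add, hcol, Finset.mul_sum] at h0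
    have h1 : ∀ k ∈ Finset.range m, PowerSeries.X ^ (m + 1) * (PowerSeries.C (d k) *
        PowerSeries.mk (fun i => cdCoeff 0 u i k))
        = ((C (d k) * X ^ (m - k) * P k : ℝ[X]) : PowerSeries ℝ) * PowerSeries.mk u
          - ((C (d k) * X ^ (m - k) * Q k : ℝ[X]) : PowerSeries ℝ)
            * PowerSeries.derivative ℝ (PowerSeries.mk u) := by
      intro k hk
      have hk' := Finset.mem_range.1 hk
      rw [show m + 1 = (m - k) + (k + 1) by omega, pow_add]
      simp only [Polynomial.coe_mul, Polynomial.coe_C, Polynomial.coe_pow, Polynomial.coe_X]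
      linear_combination (PowerSeries.X ^ (m - k) * PowerSeries.C (d k)) * hcol k
    rw [Finset.sum_congr rfl h1, Finset.sum_sub_distrib, ← Finset.sum_mul, ← Finset.sum_mul] at h0
    have hcoe : ∀ R : ℕ → ℝ[X], ((∑ k ∈ Finset.range m, R k : ℝ[X]) : PowerSeries ℝ)
        = ∑ k ∈ Finset.range m, (R k : PowerSeries ℝ) := fun R =>
      map_sum (Polynomial.coeToPowerSeries.ringHom (R := ℝ)) R (Finset.range m)
    rw [hP', hQ', Polynomial.coe_add, Polynomial.coe_add, hcoe, hcoe]
    linear_combination h0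
  obtain ⟨hP0, hQ0⟩ := polynomial_relation_trivial hv (derivative_derivative_mk hode) hrel
  have e1 := hcoeff P
  have e2 := hcoeff Q
  rw [← hP', hP0, coeff_zero, hP] at e1
  rw [← hQ', hQ0, coeff_zero, hQ] at e2
  exact hu.elim (fun h => h e2.symm) (fun h => h e1.symm)

/-- The coefficient array of `(K(x, y) - K(x, 0) K(0, y) / K(0, 0)) / (x y)` when `A` is that of
`K(x, y)`. -/
noncomputable def schurShift (A : ℕ → ℕ → ℝ) (i j : ℕ) : ℝ :=
  A (i + 1) (j + 1) - A (i + 1) 0 * A 0 (j + 1) / A 0 0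

theorem DomConv₂.schurShift {ι : Type*} {l : Filter ι} {A : ι → ℕ → ℕ → ℝ} {B : ℕ → ℕ → ℝ}
    (h : DomConv₂ l A B) (hB : B 0 0 ≠ 0) :
    DomConv₂ l (fun N => schurShift (A N)) (schurShift B) where
  tendsto i j := (h.tendsto _ _).sub (((h.tendsto _ _).mul (h.tendsto _ _)).div (h.tendsto _ _) hB)
  bound r hr := by
    obtain ⟨C, hC, hb⟩ := h.bound r hr
    have hpos : 0 < |B 0 0| := abs_pos.2 hB
    have hlow := (h.tendsto 0 0).abs.eventually_const_lt (half_lt_self hpos)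
    refine ⟨C * r ^ 2 + C * C * r ^ 2 / (|B 0 0| / 2), by positivity, ?_⟩
    filter_upwards [hb, hlow] with N h1 h2 i j
    refine (abs_sub _ _).trans ?_
    rw [abs_div, abs_mul]
    have e1 := h1 (i + 1) (j + 1)
    have e2 : |A N (i + 1) 0| * |A N 0 (j + 1)| / |A N 0 0|
        ≤ (C * r ^ (i + 1 + 0)) * (C * r ^ (0 + (j + 1))) / (|B 0 0| / 2) := by
      have := h1 (i + 1) 0
      have := h1 0 (j + 1)
      gcongr
    refine (add_le_add e1 e2).trans (le_of_eq ?_)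
    ring

/-- The coefficient arrays of the limiting kernels, without the factor `(x y)^m`. -/
noncomputable def limitCoeff (u : ℕ → ℝ) : ℕ → ℕ → ℕ → ℝ
  | 0 => cdCoeff 0 u
  | m + 1 => schurShift (limitCoeff u m)

/-- The columns of an iterated Schur complement are combinations of the columns of the initial
array, with leading coefficient one, shifted past their vanishing initial entries. -/
theorem exists_column_combination {u : ℕ → ℝ} {m : ℕ}
    (hne : ∀ l < m, limitCoeff u l 0 0 ≠ 0) (j : ℕ) :
    ∃ d : ℕ → ℝ,
      (∀ i, limitCoeff u m i j = cdCoeff 0 u (i + m) (j + m)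
        + ∑ k ∈ Finset.range m, d k * cdCoeff 0 u (i + m) k) ∧
      ∀ i < m, cdCoeff 0 u i (j + m) + ∑ k ∈ Finset.range m, d k * cdCoeff 0 u i k = 0 := by
  induction m generalizing j with
  | zero => exact ⟨0, fun i => by simp [limitCoeff], fun i hi => absurd hi (by omega)⟩
  | succ m ih =>
    have ih := ih fun l hl => hne l (by omega)
    obtain ⟨d, hd, hd0⟩ := ih (j + 1)
    obtain ⟨e, he, he0⟩ := ih 0
    have hm := hne m (by omega)
    set t := limitCoeff u m 0 (j + 1) / limitCoeff u m 0 0 with ht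
    have hcomb : ∀ i, cdCoeff 0 u i (j + (m + 1))
        + ∑ k ∈ Finset.range (m + 1), (if k = m then -t else d k - t * e k) * cdCoeff 0 u i k
        = (cdCoeff 0 u i (j + 1 + m) + ∑ k ∈ Finset.range m, d k * cdCoeff 0 u i k)
          - t * (cdCoeff 0 u i (0 + m) + ∑ k ∈ Finset.range m, e k * cdCoeff 0 u i k) := by
      intro i
      have e1 : ∑ k ∈ Finset.range m, (if k = m then -t else d k - t * e k) * cdCoeff 0 u i k
          = ∑ k ∈ Finset.range m, d k * cdCoeff 0 u i k
            - t * ∑ k ∈ Finset.range m, e k * cdCoeff 0 u i k := by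
        rw [Finset.mul_sum, ← Finset.sum_sub_distrib]
        refine Finset.sum_congr rfl fun k hk => ?_
        rw [if_neg (Finset.mem_range.1 hk).ne]
        ring
      rw [Finset.sum_range_succ, e1, if_pos rfl, zero_add, show j + (m + 1) = j + 1 + m by ring]
      ring
    refine ⟨fun k => if k = m then -t else d k - t * e k, fun i => ?_, fun i hi => ?_⟩
    · rw [hcomb, show i + (m + 1) = i + 1 + m by ring, ← hd, ← he, limitCoeff, schurShift, ht]
      ring
    · rw [hcomb]
      rcases Nat.lt_succ_iff_lt_or_eq.1 hi with h | rfl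
      · rw [hd0 i h, he0 i h, mul_zero, sub_zero]
      · have h1 := hd 0
        have h2 := he 0
        simp only [zero_add] at h1 h2 ⊢
        rw [← h1, ← h2, ht, div_mul_cancel₀ _ hm, sub_self]

/-- The Taylor coefficients at the singularity `a` of the kernel with weight `|t - a|^{2m} e^{-t²}`,
in units of `s` and without the factor `(x y)^m`. -/
noncomputable def scaledKernelCoeff (m : ℕ) (a s : ℝ) (n i j : ℕ) : ℝ :=
  s ^ (2 * m + 1 + i + j) * kernelCoeff m a n i j

theorem scaledKernelCoeff_succ (m : ℕ) (a : ℝ) {s : ℝ} (hs : 0 < s) (n : ℕ) :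
    scaledKernelCoeff (m + 1) a s n = schurShift (scaledKernelCoeff m a s (n + 1)) := by
  ext i j
  have h0 := (kernelCoeff_zero_zero_pos m a n).ne'
  simp only [scaledKernelCoeff, schurShift, kernelCoeff_succ]
  field_simp
  ring

theorem scaledKernelCoeff_sq_le (m : ℕ) (a s : ℝ) (n i : ℕ) :
    scaledKernelCoeff m a s n i 0 ^ 2
      ≤ scaledKernelCoeff m a s n i i * scaledKernelCoeff m a s n 0 0 := by
  have h := mul_le_mul_of_nonneg_left (kernelCoeff_sq_le m a n i 0)
    (sq_nonneg (s ^ (2 * m + 1 + i)))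
  simp only [scaledKernelCoeff]
  calc _ = (s ^ (2 * m + 1 + i)) ^ 2 * kernelCoeff m a n i 0 ^ 2 := by ring
    _ ≤ _ := h
    _ = _ := by ring

theorem scaledKernelCoeff_zero (a : ℝ) {s : ℝ} (hs : 0 < s) (n : ℕ) :
    scaledKernelCoeff 0 a s n = cdCoeff (s ^ 2) (scaledHermite a s n) := by
  ext i j
  rw [← kernelCoeff_zero_scaled a hs, scaledKernelCoeff]
  ring

/-- Convergence of the Taylor coefficients of the kernels for every `m`, with a nonzero leading
coefficient in the limit. The limit is the same for `N + L` particles, for every `L`, which is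
needed because the Christoffel formula leads from `N + 1` particles to `N`. -/
theorem domConv_scaledKernelCoeff {c : ℝ} {u : ℕ → ℝ} (hu : u 0 ≠ 0 ∨ u 1 ≠ 0)
    (hode : QuadODE c 1 0 u)
    (hU : ∀ L : ℕ, DomConv atTop
      (fun N => scaledHermite (softPoint c N) (softScale N) (N + L)) u) (m : ℕ) :
    (∀ L : ℕ, DomConv₂ atTop
      (fun N => scaledKernelCoeff m (softPoint c N) (softScale N) (N + L)) (limitCoeff u m)) ∧
    limitCoeff u m 0 0 ≠ 0 := by
  induction m using Nat.strong_induction_on with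
  | _ m ih =>
    have hD0 : ∀ L : ℕ, DomConv₂ atTop
        (fun N => scaledKernelCoeff 0 (softPoint c N) (softScale N) (N + L)) (cdCoeff 0 u) := by
      intro L
      refine ((hU L).cdCoeff (t := fun N => softScale N ^ 2) ?_).congr' ?_
      · simpa using tendsto_softScale.pow 2
      · filter_upwards [eventually_ge_atTop 1] with N hN
        rw [scaledKernelCoeff_zero _ (softScale_pos hN)]
    have hsymm : ∀ i j, cdCoeff 0 u i j = cdCoeff 0 u j i := fun i j =>
      tendsto_nhds_unique ((hD0 0).tendsto i j) (((hD0 0).tendsto j i).congr fun N => by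
        rw [scaledKernelCoeff, scaledKernelCoeff, kernelCoeff_symm, add_right_comm])
    have hD : ∀ L : ℕ, DomConv₂ atTop
        (fun N => scaledKernelCoeff m (softPoint c N) (softScale N) (N + L))
        (limitCoeff u m) := by
      rcases m with _ | m
      · exact hD0
      · intro L
        obtain ⟨h1, h2⟩ := ih m (Nat.lt_succ_self m)
        refine ((h1 (L + 1)).schurShift h2).congr' ?_
        filter_upwards [eventually_ge_atTop 1] with N hN
        rw [scaledKernelCoeff_succ m _ (softScale_pos hN), add_assoc]
    refine ⟨hD, fun h0 => ?_⟩
    -- a vanishing corner of a positive semidefinite array forces its first column to vanish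
    have hcol : ∀ i, limitCoeff u m i 0 = 0 := by
      intro i
      have h := le_of_tendsto_of_tendsto' (((hD 0).tendsto i 0).pow 2)
        (((hD 0).tendsto i i).mul ((hD 0).tendsto 0 0))
        (fun N => scaledKernelCoeff_sq_le m _ _ _ i)
      rw [h0, mul_zero] at h
      exact pow_eq_zero_iff two_ne_zero |>.1 (le_antisymm h (sq_nonneg _))
    obtain ⟨d, hd, hd0⟩ := exists_column_combination (u := u) (m := m)
      (fun l hl => (ih l hl).2) 0
    refine cdCoeff_columns_independent hode hu hsymm m d fun i => ?_
    rcases lt_or_ge i m with hi | hi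
    · simpa using hd0 i hi
    · obtain ⟨i, rfl⟩ := Nat.exists_eq_add_of_le' hi
      have := hd i
      rw [hcol, zero_add] at this
      exact this.symm

/-! ### The limiting kernels and the recursion -/

/-- The limiting kernel for the exponent `2m`, without the factor `(x y)^m`. -/
noncomputable def limitKernel (u : ℕ → ℝ) (m : ℕ) (x y : ℝ) : ℝ :=
  ∑' ij : ℕ × ℕ, limitCoeff u m ij.1 ij.2 * x ^ ij.1 * y ^ ij.2

/-- The limit `N → ∞` of the Christoffel formula, as an identity of double power series. -/
theorem tsum_schurShift {A : ℕ → ℕ → ℝ} (hA : A 0 0 ≠ 0)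
    (hs : ∀ x y : ℝ, Summable fun ij : ℕ × ℕ => A ij.1 ij.2 * x ^ ij.1 * y ^ ij.2) (x y : ℝ) :
    x * y * ∑' ij : ℕ × ℕ, schurShift A ij.1 ij.2 * x ^ ij.1 * y ^ ij.2
      = (∑' ij : ℕ × ℕ, A ij.1 ij.2 * x ^ ij.1 * y ^ ij.2)
        - (∑' ij : ℕ × ℕ, A ij.1 ij.2 * x ^ ij.1 * 0 ^ ij.2)
          * (∑' ij : ℕ × ℕ, A ij.1 ij.2 * 0 ^ ij.1 * y ^ ij.2) / A 0 0 := by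
  have hcol : HasSum (fun i => A i 0 * x ^ i)
      (∑' ij : ℕ × ℕ, A ij.1 ij.2 * x ^ ij.1 * 0 ^ ij.2) := by
    have hinj : Function.Injective fun i : ℕ => (i, 0) := fun i j h => by simpa using h
    refine HasSum.congr_fun ((hinj.hasSum_iff ?_).2 (hs x 0).hasSum) ?_
    · rintro ⟨i, j⟩ hij
      have hj : j ≠ 0 := by
        rintro rfl
        exact hij ⟨i, rfl⟩
      simp [hj]
    · intro i
      simp
  have hrow : HasSum (fun j => A 0 j * y ^ j)
      (∑' ij : ℕ × ℕ, A ij.1 ij.2 * 0 ^ ij.1 * y ^ ij.2) := by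
    have hinj : Function.Injective fun j : ℕ => (0, j) := fun i j h => by simpa using h
    refine HasSum.congr_fun ((hinj.hasSum_iff ?_).2 (hs 0 y).hasSum) ?_
    · rintro ⟨i, j⟩ hij
      have hi : i ≠ 0 := by
        rintro rfl
        exact hij ⟨j, rfl⟩
      simp [hi]
    · intro i
      simp
  have hprod := hcol.mul hrow (summable_mul_of_summable_norm hcol.summable.norm
    hrow.summable.norm)
  have hR := (hs x y).hasSum.sub (hprod.div_const (A 0 0))
  -- the Schur complement vanishes in the first row and the first column
  have hinj : Function.Injective fun ij : ℕ × ℕ => (ij.1 + 1, ij.2 + 1) := by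
    rintro ⟨i, j⟩ ⟨i', j'⟩ h
    simpa using h
  rw [← hinj.hasSum_iff] at hR
  · rw [← tsum_mul_left, ← hR.tsum_eq]
    refine tsum_congr fun ij => ?_
    simp only [Function.comp, schurShift]
    ring
  · rintro ⟨i, j⟩ hij
    rcases i with _ | i
    · field_simp
      simp
    rcases j with _ | j
    · field_simp
      simp
    exact absurd ⟨(i, j), rfl⟩ hij

theorem tsum_scaledKernelCoeff (m : ℕ) (a s : ℝ) (n : ℕ) (x y : ℝ) :
    ∑' ij : ℕ × ℕ, scaledKernelCoeff m a s n ij.1 ij.2 * x ^ ij.1 * y ^ ij.2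
      = s ^ (2 * m + 1) * (Real.exp (-(a + x * s) ^ 2 / 2) * Real.exp (-(a + y * s) ^ 2 / 2) *
        polyKernel (gueWeight (2 * (m : ℝ)) a) n (a + x * s) (a + y * s)) := by
  have h := (hasSum_kernelCoeff m a n (x * s) (y * s)).mul_left (s ^ (2 * m + 1))
  rw [← h.tsum_eq]
  refine tsum_congr fun ij => ?_
  rw [scaledKernelCoeff]
  ring

theorem softRescale_smoothKernel (m : ℕ) (c x y : ℝ) (N : ℕ) :
    softRescale (smoothKernel m) c x y N = x ^ m * y ^ m * ∑' ij : ℕ × ℕ,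
      scaledKernelCoeff m (softPoint c N) (softScale N) N ij.1 ij.2 * x ^ ij.1 * y ^ ij.2 := by
  rw [tsum_scaledKernelCoeff]
  simp only [softRescale, smoothKernel, smoothRoot]
  ring

theorem absKernel_eq (m : ℕ) (a : ℝ) (N : ℕ) (X Y : ℝ) : absKernel (2 * (m : ℝ)) a N X Y
    = |smoothRoot m a X| * |smoothRoot m a Y| * polyKernel (gueWeight (2 * (m : ℝ)) a) N X Y := by
  rw [absKernel, ← smoothRoot_sq, ← smoothRoot_sq, ← mul_pow, Real.sqrt_sq_eq_abs, abs_mul]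

theorem softRescale_absKernel (m : ℕ) (c x y : ℝ) (N : ℕ) :
    softRescale (absKernel (2 * (m : ℝ))) c x y N = |x| ^ m * |y| ^ m * ∑' ij : ℕ × ℕ,
      scaledKernelCoeff m (softPoint c N) (softScale N) N ij.1 ij.2 * x ^ ij.1 * y ^ ij.2 := by
  have hs : 0 ≤ softScale N := by
    rw [softScale]
    positivity
  rw [tsum_scaledKernelCoeff]
  simp only [softRescale, absKernel_eq, smoothRoot, abs_mul, abs_pow, Real.abs_exp,
    add_sub_cancel_left, abs_of_nonneg hs]
  ring

/-- The limit `z → 0` of the conditioned kernel, for a kernel `ρ(x) ρ(y) K(x, y)`: the factors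
`ρ(z)` cancel, and the limit can be taken in the continuous kernel `K`. -/
theorem tendsto_conditionedAt {k K : ℝ → ℝ → ℝ} {ρ : ℝ → ℝ} (hρ : ∀ z, z ≠ 0 → ρ z ≠ 0)
    (hk : ∀ s t, k s t = ρ s * ρ t * K s t) (x y : ℝ) (h0 : K 0 0 ≠ 0)
    (hdiag : Tendsto (fun z => K z z) (𝓝[≠] 0) (𝓝 (K 0 0)))
    (hx : Tendsto (fun z => K x z) (𝓝[≠] 0) (𝓝 (K x 0)))
    (hy : Tendsto (fun z => K z y) (𝓝[≠] 0) (𝓝 (K 0 y))) :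
    (∀ᶠ z in 𝓝[≠] (0 : ℝ), k z z ≠ 0) ∧
    Tendsto (fun z => conditionedAt k x y z) (𝓝[≠] 0)
      (𝓝 (ρ x * ρ y * (K x y - K x 0 * K 0 y / K 0 0))) := by
  have hne : ∀ᶠ z in 𝓝[≠] (0 : ℝ), K z z ≠ 0 ∧ z ≠ 0 :=
    (hdiag.eventually_ne h0).and self_mem_nhdsWithin
  refine ⟨hne.mono fun z hz => ?_, ?_⟩
  · rw [hk]
    exact mul_ne_zero (mul_ne_zero (hρ z hz.2) (hρ z hz.2)) hz.1
  · have h := ((hx.mul hy).div hdiag h0).const_sub (K x y) |>.const_mul (ρ x * ρ y)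
    refine h.congr' (hne.mono fun z hz => ?_)
    have h1 := hρ z hz.2
    have h2 := hz.1
    simp only [conditionedAt, hk, Pi.div_apply]
    field_simp

theorem propositionC5 (m : ℕ) (x y c : ℝ) :
    -- the limits that define the kernels exist, and the quotient is meaningful near `z = 0`
    (Filter.Tendsto (softRescale (smoothKernel m) c x y) Filter.atTop
        (nhds (softKernel m x y c)) ∧
      Filter.Tendsto (softRescale (smoothKernel (m + 1)) c x y) Filter.atTop
        (nhds (softKernel (m + 1) x y c)) ∧
      (∀ᶠ z in nhdsWithin (0 : ℝ) {0}ᶜ, softKernel m z z c ≠ 0) ∧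
    -- the recursion
      Filter.Tendsto (fun z : ℝ => conditionedAt (fun s t => softKernel m s t c) x y z)
        (nhdsWithin (0 : ℝ) {0}ᶜ) (nhds (softKernel (m + 1) x y c))) ∧
    -- the same for the kernels with the nonnegative square root of the weight, which agree with
    -- the previous ones up to a sign
    (Filter.Tendsto (softRescale (absKernel (2 * (m : ℝ))) c x y) Filter.atTop
        (nhds (softAbsKernel (2 * (m : ℝ)) x y c)) ∧
      Filter.Tendsto (softRescale (absKernel (2 * (m : ℝ) + 2)) c x y) Filter.atTop
        (nhds (softAbsKernel (2 * (m : ℝ) + 2) x y c)) ∧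
      (∀ᶠ z in nhdsWithin (0 : ℝ) {0}ᶜ, softAbsKernel (2 * (m : ℝ)) z z c ≠ 0) ∧
      Filter.Tendsto
        (fun z : ℝ => conditionedAt (fun s t => softAbsKernel (2 * (m : ℝ)) s t c) x y z)
        (nhdsWithin (0 : ℝ) {0}ᶜ)
        (nhds ((if 0 ≤ x * y then 1 else -1) * softAbsKernel (2 * (m : ℝ) + 2) x y c))) := by
  obtain ⟨u, hu, hode, hU⟩ := exists_edge_limit c
  have hD := fun m => (domConv_scaledKernelCoeff hu hode hU m).1 0
  have h0 := fun m => (domConv_scaledKernelCoeff hu hode hU m).2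
  have hsmooth : ∀ m x y, Tendsto (softRescale (smoothKernel m) c x y) atTop
      (𝓝 (x ^ m * y ^ m * limitKernel u m x y)) := fun m x y =>
    (((hD m).tendsto_tsum (tendsto_const_nhds (x := x)) (tendsto_const_nhds (x := y))).const_mul
      (x ^ m * y ^ m)).congr fun N => (softRescale_smoothKernel m c x y N).symm
  have habs : ∀ m x y, Tendsto (softRescale (absKernel (2 * ((m : ℕ) : ℝ))) c x y) atTop
      (𝓝 (|x| ^ m * |y| ^ m * limitKernel u m x y)) := fun m x y =>
    (((hD m).tendsto_tsum (tendsto_const_nhds (x := x)) (tendsto_const_nhds (x := y))).const_mul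
      (|x| ^ m * |y| ^ m)).congr fun N => (softRescale_absKernel m c x y N).symm
  have hsoft : ∀ m x y, softKernel m x y c = x ^ m * y ^ m * limitKernel u m x y :=
    fun m x y => (hsmooth m x y).limUnder_eq
  have hsoftabs : ∀ (m : ℕ) x y, softAbsKernel (2 * (m : ℝ)) x y c
      = |x| ^ m * |y| ^ m * limitKernel u m x y := fun m x y => (habs m x y).limUnder_eq
  have hcast : 2 * (m : ℝ) + 2 = 2 * ((m + 1 : ℕ) : ℝ) := by push_cast; ring
  have hcont : ∀ {f g : ℝ → ℝ} {a b : ℝ}, Tendsto f (𝓝[≠] 0) (𝓝 a) →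
      Tendsto g (𝓝[≠] 0) (𝓝 b) → Tendsto (fun z => limitKernel u m (f z) (g z)) (𝓝[≠] (0 : ℝ))
        (𝓝 (limitKernel u m a b)) := fun hf hg =>
    ((hD m).of_eq (𝓝[≠] (0 : ℝ))).tendsto_tsum hf hg
  have hid : Tendsto (fun z : ℝ => z) (𝓝[≠] 0) (𝓝 0) := tendsto_id.mono_left nhdsWithin_le_nhds
  have h00 : limitKernel u m 0 0 = limitCoeff u m 0 0 := by
    rw [limitKernel, tsum_eq_single (0, 0)]
    · simp
    · rintro ⟨i, j⟩ hij
      rcases i with _ | i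
      · rcases j with _ | j
        · exact absurd rfl hij
        · simp
      · simp
  have hrec : x * y * limitKernel u (m + 1) x y = limitKernel u m x y
      - limitKernel u m x 0 * limitKernel u m 0 y / limitKernel u m 0 0 := by
    rw [h00]
    exact tsum_schurShift (h0 m) (fun x y => (hD m).summable x y) x y
  have hK0 : limitKernel u m 0 0 ≠ 0 := by rw [h00]; exact h0 m
  have hcond := tendsto_conditionedAt (k := fun s t => softKernel m s t c)
    (K := limitKernel u m) (ρ := fun z => z ^ m) (fun z hz => pow_ne_zero m hz)
    (fun s t => hsoft m s t) x y hK0 (hcont hid hid) (hcont tendsto_const_nhds hid)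
    (hcont hid tendsto_const_nhds)
  have hcondabs := tendsto_conditionedAt (k := fun s t => softAbsKernel (2 * (m : ℝ)) s t c)
    (K := limitKernel u m) (ρ := fun z => |z| ^ m)
    (fun z hz => pow_ne_zero m (abs_ne_zero.2 hz))
    (fun s t => hsoftabs m s t) x y hK0 (hcont hid hid) (hcont tendsto_const_nhds hid)
    (hcont hid tendsto_const_nhds)
  rw [← hrec] at hcond hcondabs
  refine ⟨⟨?_, ?_, hcond.1, ?_⟩, ?_, ?_, hcondabs.1, ?_⟩
  · rw [hsoft]
    exact hsmooth m x y
  · rw [hsoft]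
    exact hsmooth (m + 1) x y
  · rw [hsoft]
    convert! hcond.2 using 2
    ring
  · rw [hsoftabs]
    exact habs m x y
  · rw [hcast, hsoftabs]
    exact habs (m + 1) x y
  · rw [hcast, hsoftabs]
    convert! hcondabs.2 using 2
    have hsign : (if 0 ≤ x * y then (1 : ℝ) else -1) * (|x| * |y|) = x * y := by
      rw [← abs_mul]
      split_ifs with h
      · rw [one_mul, abs_of_nonneg h]
      · rw [abs_of_neg (not_le.1 h)]
        ring
    linear_combination (|x| ^ m * |y| ^ m * limitKernel u (m + 1) x y) * hsign
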